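/- Let $X$ be a finite or countably infinite set, $Y=\{0,1\}$, and let $C$ be a class of functions $X\to Y$ of finite VC dimension $d$. Fix a deterministic oracle $\mathsf{ERM}_C$ which, given any finite sequence of labeled examples from $X\times Y$, outputs a classifier in $C$ with the fewest errors on it among all classifiers in $C$. *Notation.* For a distribution $D$ on $X$, $h:X\to Y$, $S\subseteq X$ and a target $f\in C$, put $\mathrm{err}_D=\Pr_{x\sim D}[h(x)\ne f(x)\wedge x\in S]$ and $\mathrm{rej}_D=\Pr_{x\sim D}[x\notin S]$. For $\mathbf z\in X^n$ and $c:X\to Y$ put $\mathrm{err}_{\mathbf z}(h|_S,c)=\frac1n|\{i: c(z_i)\ne h(z_i)\wedge z_i\in S\}|$, and write $\mathrm{err}_{\mathbf z}(h,c)$ when $S=X$. *Rejectron.* On input $\mathbf x\in X^n$, $\mathbf y\in Y^n$, $\tilde{\mathbf x}\in X^n$, $\varepsilon$, and with weight $\Lambda=n+1$, the algorithm $\mathsf{Rejectron}(\mathbf x,\mathbf y,\tilde{\mathbf x},\varepsilon)$ sets $h=\mathsf{ERM}_C(\mathbf x,\mathbf y)$. Then, for $t=1,2,\dots$, it lets $S_t=\{x\in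 X: h(x)=c_1(x)=\dots=c_{t-1}(x)\}$ and chooses $c_t\in C$ maximizing $s_t(c)=\mathrm{err}_{\tilde{\mathbf x}}(h|_{S_t},c)-\Lambda\,\mathrm{err}_{\mathbf x}(h,c)$ over $c\in C$. If $s_t(c_t)\le\varepsilon$, it stops and returns $h|_{S_t}$. *Massart noise.* For a distribution $P$ on $X$, $f\in C$, $\eta<1/2$ and a function $x\mapsto\eta(x)\in[0,\eta]$, the Massart distribution $P_\eta$ on $X\times Y$ draws $x\sim P$ and then $y=f(x)$ with probability $1-\eta(x)$ and $y=1-f(x)$ with probability $\eta(x)$. **Statement (PQ guarantees under Massart noise).** There is an absolute constant $K>0$ such that the following holds for all $X$, $C$, $d$, $\mathsf{ERM}_C$ as above, all integers $n\ge1$, all $\delta>0$, all $f\in C$, all distributions $P,Q$ on $X$, all $\eta<1/2$, all $\eta:X\to[0,\eta]$, and every integer $N\ge 0$ with $$N\ \ge\ K\cdot\frac{dn^2+\log_2(2/\delta)}{\delta^2(1-2\eta)^2}.$$ Let $\varepsilon^*=\sqrt{\frac{8d\ln(2n)}{n}}+\frac{8\ln(32/\delta)}{n}$. Draw independently $(\mathbf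 x',\mathbf y')\sim P_\eta^N$, $(\mathbf x,\mathbf y)\sim P_\eta^n$ and $\tilde{\mathbf x}\sim Q^n$, let $\hat h=\mathsf{ERM}_C(\mathbf x',\mathbf y')$, and run $\mathsf{Rejectron}(\mathbf x,\hat h(\mathbf x),\tilde{\mathbf x},\varepsilon^*)$. Then, with probability at least $1-\delta$, the algorithm terminates and, however ties between maximizers $c_t$ are broken, its output $h|_S$ satisfies $$\mathrm{err}_Q\le2\varepsilon^*\quad\text{and}\quad\mathrm{rej}_P\le\varepsilon^*.$$ -/

import Mathlib

open MeasureTheory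

namespace Redaction

noncomputable section

/-- `C` shatters the finite set `s`: every labeling of `s` is realized by some classifier in `C`.
Classifiers are functions `X → Bool`, with `Bool` playing the role of the label set `{0, 1}`. -/
def Shatters {X : Type*} (C : Set (X → Bool)) (s : Finset X) : Prop :=
  ∀ g : X → Bool, ∃ c ∈ C, ∀ x ∈ s, c x = g x

/-- The VC dimension of `C`: the supremum of the cardinalities of the finite shattered sets. -/
def vcDim {X : Type*} (C : Set (X → Bool)) : ℕ∞ :=
  ⨆ (s : Finset X) (_ : Shatters C s), (s.card : ℕ∞)

/-- The empirical error `err_x(h|_S, f) = (1/n) |{i : f(x_i) ≠ h(x_i) and x_i ∈ S}|` of a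
selective classifier. -/
def empErr {X : Type*} {n : ℕ} (x : Fin n → X) (h : X → Bool) (S : Set X) (f : X → Bool) : ℝ :=
  ({i : Fin n | f (x i) ≠ h (x i) ∧ x i ∈ S}.ncard : ℝ) / n

/-- The error `err_D(h|_S) = Pr_{x ∼ D}[h(x) ≠ f(x) and x ∈ S]`. -/
def err {X : Type*} [MeasurableSpace X] (D : Measure X) (h : X → Bool) (S : Set X)
    (f : X → Bool) : ℝ :=
  D.real {x | h x ≠ f x ∧ x ∈ S}

/-- The rejection rate `rej_D(S) = Pr_{x ∼ D}[x ∉ S]`. -/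
def rej {X : Type*} [MeasurableSpace X] (D : Measure X) (S : Set X) : ℝ :=
  D.real {x | x ∉ S}

/-- `ERM` is a (deterministic) empirical risk minimization oracle for `C`: given any finite
sequence of labeled examples, it outputs a classifier in `C` making the fewest errors on it
among all classifiers in `C`. -/
def IsERM {X : Type*} (C : Set (X → Bool))
    (ERM : (m : ℕ) → (Fin m → X) → (Fin m → Bool) → X → Bool) : Prop :=
  ∀ (m : ℕ) (x : Fin m → X) (y : Fin m → Bool),
    ERM m x y ∈ C ∧
      ∀ c ∈ C, {i : Fin m | ERM m x y (x i) ≠ y i}.ncard ≤ {i : Fin m | c (x i) ≠ y i}.ncard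

/-- The set `{x : h(x) = c_0(x) = … = c_{t-1}(x)}` (all of `X` for `t = 0`). -/
def agreeSet {X : Type*} (h : X → Bool) (c : ℕ → X → Bool) (t : ℕ) : Set X :=
  {x | ∀ i < t, c i x = h x}

/-- The score `s(c) = err_{x̃}(h|_S, c) - Λ · err_x(h, c)` maximized in an iteration of Rejectron
whose current selection set is `S`. -/
def score {X : Type*} {n : ℕ} (x xt : Fin n → X) (Λ : ℝ) (h : X → Bool) (S : Set X)
    (c : X → Bool) : ℝ :=
  empErr xt h S c - Λ * empErr x h Set.univ c

/-- `h|_S` is a possible output of `Rejectron(x, y, x̃, ε, Λ)`, run over the class `C` with the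
oracle `ERM`. The iterations are numbered from `0`, and iteration `T` is the one that stops.
In iteration `t` the algorithm picks any maximizer `c t` over `C` of the score with respect to
`S_t = agreeSet h c t`; it goes on if the score of `c t` exceeds `ε`, and otherwise it stops and
returns `h|_{S_t}`. No rule for breaking ties between maximizers is prescribed. -/
def IsRejectronOutput {X : Type*} (C : Set (X → Bool))
    (ERM : (m : ℕ) → (Fin m → X) → (Fin m → Bool) → X → Bool)
    {n : ℕ} (x : Fin n → X) (y : Fin n → Bool) (xt : Fin n → X) (ε Λ : ℝ)
    (h : X → Bool) (S : Set X) : Prop :=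
  h = ERM n x y ∧
    ∃ (T : ℕ) (c : ℕ → X → Bool),
      (∀ t ≤ T, c t ∈ C ∧ ∀ c' ∈ C,
        score x xt Λ h (agreeSet h c t) c' ≤ score x xt Λ h (agreeSet h c t) (c t)) ∧
      (∀ t < T, ε < score x xt Λ h (agreeSet h c t) (c t)) ∧
      score x xt Λ h (agreeSet h c T) (c T) ≤ ε ∧
      S = agreeSet h c T

/-- Every run of `Rejectron(x, y, x̃, ε, Λ)` stops: whichever maximizers `c t` are picked, some
iteration has maximal score at most `ε`. -/
def RejectronTerminates {X : Type*} (C : Set (X → Bool))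
    (ERM : (m : ℕ) → (Fin m → X) → (Fin m → Bool) → X → Bool)
    {n : ℕ} (x : Fin n → X) (y : Fin n → Bool) (xt : Fin n → X) (ε Λ : ℝ) : Prop :=
  ∀ c : ℕ → X → Bool,
    (∀ t, c t ∈ C ∧ ∀ c' ∈ C,
      score x xt Λ (ERM n x y) (agreeSet (ERM n x y) c t) c' ≤
        score x xt Λ (ERM n x y) (agreeSet (ERM n x y) c t) (c t)) →
    ∃ T, score x xt Λ (ERM n x y) (agreeSet (ERM n x y) c T) (c T) ≤ ε

/-- The Massart distribution on `X × {0, 1}`: draw `x ∼ P`, then `y = f(x)` with probability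
`1 - η(x)` and `y = 1 - f(x)` with probability `η(x)`. -/
def massart {X : Type*} [MeasurableSpace X] (P : Measure X) (f : X → Bool) (η : X → ℝ) :
    Measure (X × Bool) :=
  P.bind fun x =>
    ENNReal.ofReal (1 - η x) • Measure.dirac (x, f x) +
      ENNReal.ofReal (η x) • Measure.dirac (x, !(f x))

end

end Redaction

namespace Redaction

/-! Denoising reduces the problem to clean labels. Under Massart noise the excess noisy error of a
classifier is at least `1 - 2η` times its distance to `f` (`massart_excess_error`), and the expected
excess error of empirical risk minimization over a VC class is `O(√(d / N))`, with no logarithm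
lost, by symmetrization and Dudley chaining (`sum_rademacher_le`, `integral_sub_empirical_le`). The
size of `N` brings the expected distance to `f` down to `δ / (4n)`, so a union bound over the `n`
fresh training points shows that the learned labels are all correct except with probability `δ / 4`.

With correct labels the run is deterministic in nature (`IsRejectronOutput.spec`). The weight `n +
1` forbids any disagreement with `h` on training points, so none of them is rejected. Each round
removes at least `ε n` test points, so there are at most `1 / ε` rounds. The target competes in the
last round, so `h` errs on at most `ε n` selected test points.

The rejected set and the error set are thus determined by few members of `C`. A relative deviation
bound (`measureReal_exists_rarely_hit_le`) excludes a rejected set of `P`-measure above `ε` that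
misses every training point, and an error set of `Q`-measure above `2ε` hit by at most `ε n` test
points. The constants allow about `1.34 / ε` classifiers in the error bound. Rounding leaves one
case over, two rounds with `ε ≥ 0.44`; there so few test points survive that a separate bound
applies. -/

/-- Every finite set shattered by `C` has at most `d` elements. -/
def HasVC {X : Type*} (C : Set (X → Bool)) (d : ℕ) : Prop :=
  ∀ s : Finset X, Shatters C s → s.card ≤ d

/-! ### VC dimension under pullback and relabeling. -/

section VC

variable {X κ : Type*} {C : Set (X → Bool)} {d : ℕ}

lemma hasVC_of_vcDim_eq (h : vcDim C = d) : HasVC C d := by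
  intro s hs
  have h1 : (s.card : ℕ∞) ≤ vcDim C := le_iSup₂_of_le s hs le_rfl
  rw [h] at h1
  exact_mod_cast h1

lemma HasVC.mono {C' : Set (X → Bool)} (h : HasVC C d) (hC : C' ⊆ C) : HasVC C' d := by
  intro s hs
  refine h s fun g => ?_
  obtain ⟨c, hc, hcg⟩ := hs g
  exact ⟨c, hC hc, hcg⟩

/-- Two indices with the same image cannot receive different labels, so `v` is injective on a
shattered set and its image is shattered as well. This serves both for restriction to a sample and
for pulling back to labeled points. -/
lemma HasVC.comp (h : HasVC C d) (v : κ → X) : HasVC ((fun c => c ∘ v) '' C) d := by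
  classical
  intro s hs
  have hinj : Set.InjOn v s := by
    intro a ha b hb hab
    by_contra hne
    obtain ⟨_, ⟨c, -, rfl⟩, hc⟩ := hs fun i => decide (i = a)
    have h1 := hc a ha
    have h2 := hc b hb
    simp only [Function.comp, hab] at h1 h2
    rw [h1] at h2
    simp [Ne.symm hne] at h2
  rw [← Finset.card_image_of_injOn hinj]
  refine h _ fun g => ?_
  obtain ⟨_, ⟨c, hcC, rfl⟩, hc⟩ := hs (g ∘ v)
  refine ⟨c, hcC, fun x hx => ?_⟩
  obtain ⟨i, hi, rfl⟩ := Finset.mem_image.1 hx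
  exact hc i hi

/-- Flipping by a fixed `y` permutes the labelings. It turns classifiers into their 0-1 losses
against noisy labels. -/
lemma HasVC.xor (h : HasVC C d) (y : X → Bool) :
    HasVC ((fun c x => Bool.xor (c x) (y x)) '' C) d := by
  intro s hs
  refine h s fun g => ?_
  obtain ⟨_, ⟨c, hcC, rfl⟩, hc⟩ := hs fun x => Bool.xor (g x) (y x)
  exact ⟨c, hcC, fun x hx => by simpa using hc x hx⟩

end VC

/-! ### Sauer-Shelah, packing numbers and nets. -/

section Sauer

open Finset

variable {ι : Type*} [Fintype ι] [DecidableEq ι] {M : Finset (ι → Bool)} {d : ℕ}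

/-- The **Sauer-Shelah lemma** for a family of Boolean functions. -/
lemma card_le_sum_choose (hM : HasVC (M : Set (ι → Bool)) d) :
    #M ≤ ∑ k ∈ range (d + 1), (Fintype.card ι).choose k := by
  classical
  let F : (ι → Bool) → Finset ι := fun c => univ.filter fun i => c i = true
  have hF : Function.Injective F := by
    intro c c' h
    funext i
    have : i ∈ F c ↔ i ∈ F c' := by rw [h]
    simp only [F, mem_filter, mem_univ, true_and] at this
    exact Bool.eq_iff_iff.2 this
  have hvc : (M.image F).vcDim ≤ d := by
    refine Finset.sup_le fun s hs => hM s fun g => ?_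
    obtain ⟨u, hu, hsu⟩ := mem_shatterer.1 hs (t := s.filter fun i => g i = true) (filter_subset _ _)
    obtain ⟨c, hc, rfl⟩ := mem_image.1 hu
    refine ⟨c, hc, fun x hx => ?_⟩
    have : x ∈ s ∩ F c ↔ x ∈ s.filter fun i => g i = true := by rw [hsu]
    simp only [F, mem_inter, mem_filter, mem_univ, true_and, hx] at this
    exact Bool.eq_iff_iff.2 this
  rw [← card_image_of_injective M hF]
  refine (card_le_card_shatterer _).trans (card_shatterer_le_sum_vcDim.trans ?_)
  refine sum_le_sum_of_subset fun k hk => ?_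
  have := (mem_Iic.1 hk).trans hvc
  exact mem_range.2 (by omega)

lemma sum_choose_le_pow (m d : ℕ) : ∑ k ∈ range (d + 1), m.choose k ≤ (m + 1) ^ d := by
  induction d with
  | zero => simp
  | succ d ih =>
    rw [sum_range_succ]
    have h1 : m.choose (d + 1) ≤ m ^ (d + 1) := Nat.choose_le_pow _ _
    have h2 : m ^ d ≤ (m + 1) ^ d := Nat.pow_le_pow_left (Nat.le_succ m) d
    calc _ ≤ (m + 1) ^ d + m ^ (d + 1) := add_le_add ih h1
      _ ≤ (m + 1) ^ d + m * (m + 1) ^ d := by rw [pow_succ']; gcongr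
      _ = _ := by ring

lemma card_le_pow (hM : HasVC (M : Set (ι → Bool)) d) : #M ≤ (Fintype.card ι + 1) ^ d :=
  (card_le_sum_choose hM).trans (sum_choose_le_pow _ _)

/-- Since `x ≤ 1`, the weight `x ^ d` is at most `x ^ k` for `k ≤ d`, and the binomial theorem sums
the rest. Unlike `(em/d)^d`, this form needs no relation between `d` and the number of points. -/
lemma pow_mul_card_le_exp (hM : HasVC (M : Set (ι → Bool)) d) {x : ℝ} (hx : 0 < x) (hx1 : x ≤ 1) :
    x ^ d * #M ≤ Real.exp (x * Fintype.card ι) := by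
  set m := Fintype.card ι
  have h1 : (#M : ℝ) ≤ ∑ k ∈ range (d + 1), (m.choose k : ℝ) := by
    exact_mod_cast card_le_sum_choose hM
  have h2 : ∀ D, ∑ k ∈ range D, x ^ k * (m.choose k : ℝ) ≤ (x + 1) ^ m := by
    intro D
    rw [add_pow]
    simp only [one_pow, mul_one]
    rw [← sum_subset (s₁ := range (min D (m + 1))) (s₂ := range D)]
    · exact sum_le_sum_of_subset_of_nonneg (range_mono (min_le_right _ _))
        fun _ _ _ => by positivity
    · exact range_mono (min_le_left _ _)
    · intro k hk hk'
      simp only [mem_range, lt_min_iff, not_and, not_lt] at hk hk'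
      rw [Nat.choose_eq_zero_of_lt (by have := hk' hk; omega)]
      simp
  calc x ^ d * #M ≤ x ^ d * ∑ k ∈ range (d + 1), (m.choose k : ℝ) := by gcongr
    _ ≤ ∑ k ∈ range (d + 1), x ^ k * (m.choose k : ℝ) := by
      rw [mul_sum]
      refine sum_le_sum fun k hk => ?_
      have := mem_range.1 hk
      exact mul_le_mul_of_nonneg_right (pow_le_pow_of_le_one hx.le hx1 (by omega)) (by positivity)
    _ ≤ (x + 1) ^ m := h2 _
    _ ≤ Real.exp x ^ m := by gcongr; exact Real.add_one_le_exp x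
    _ = Real.exp (x * m) := by rw [← Real.exp_nat_mul]; ring_nf

/-- **Dudley's packing bound**, with explicit constants, for `ε`-separated subsets of a VC class. -/
lemma log_card_le_of_separated (hM : HasVC (M : Set (ι → Bool)) d) {ε : ℝ} (hε : 0 < ε)
    (hε1 : ε ≤ 1)
    (hsep : ∀ A ∈ M, ∀ B ∈ M, A ≠ B → ε * Fintype.card ι < #{i | A i ≠ B i}) :
    Real.log #M ≤ 2 * d * Real.log (4 / ε) + 1 / 2 := by
  classical
  have hlog4 : 0 ≤ Real.log (4 / ε) := Real.log_nonneg (by rw [le_div_iff₀ hε]; linarith)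
  rcases Nat.lt_or_ge 1 #M with hk | hk
  swap
  · have : Real.log #M ≤ 0 := Real.log_nonpos (by positivity) (by exact_mod_cast hk)
    have h2 : 0 ≤ 2 * d * Real.log (4 / ε) := by positivity
    linarith
  set N := Fintype.card ι
  set k := #M
  -- A pair of `ε`-separated functions agrees on `m` random points with probability at most `exp (-ε
  -- m) ≤ 1 / k ^ 2`. There are fewer than `k ^ 2` pairs, so some tuple distinguishes all of `M`.
  set m := ⌈2 * Real.log k / ε⌉₊
  have hkpos : (0 : ℝ) < k := by exact_mod_cast (by omega : 0 < k)
  obtain ⟨A₀, hA₀, B₀, hB₀, hAB₀⟩ := one_lt_card.1 hk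
  have hN : 0 < N := by
    rcases Nat.eq_zero_or_pos N with h | h
    · have : IsEmpty ι := Fintype.card_eq_zero_iff.1 h
      exact absurd (Subsingleton.elim A₀ B₀) hAB₀
    · exact h
  have hNr : (0 : ℝ) < N := by exact_mod_cast hN
  have hmlow : 2 * Real.log k / ε ≤ m := Nat.le_ceil _
  have hlogk : 0 ≤ Real.log k := Real.log_nonneg (by exact_mod_cast hk.le)
  have hmup : (m : ℝ) ≤ 2 * Real.log k / ε + 1 := (Nat.ceil_lt_add_one (by positivity)).le
  -- a tuple separating all of `M`
  have hv : ∃ v : Fin m → ι, Set.InjOn (fun A : ι → Bool => A ∘ v) M := by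
    by_contra! hcon
    have hcover : (univ : Finset (Fin m → ι)) ⊆
        M.offDiag.biUnion fun p => univ.filter fun v => p.1 ∘ v = p.2 ∘ v := by
      intro v _
      have := hcon v
      simp only [Set.InjOn, not_forall] at this
      obtain ⟨A, hA, B, hB, h, hne⟩ := this
      exact mem_biUnion.2 ⟨(A, B), mem_offDiag.2 ⟨hA, hB, hne⟩, by simpa using h⟩
    have hcard : (N : ℝ) ^ m ≤ ∑ p ∈ M.offDiag, ((N : ℝ) ^ m * (1 / (k : ℝ) ^ 2)) := by
      have h1 : N ^ m ≤ ∑ p ∈ M.offDiag,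
          #(univ.filter fun v : Fin m → ι => p.1 ∘ v = p.2 ∘ v) := by
        calc N ^ m = #(univ : Finset (Fin m → ι)) := by simp [N]
          _ ≤ _ := card_le_card hcover
          _ ≤ _ := card_biUnion_le
      have h2 : (N : ℝ) ^ m ≤ ∑ p ∈ M.offDiag,
          (#(univ.filter fun v : Fin m → ι => p.1 ∘ v = p.2 ∘ v) : ℝ) := by exact_mod_cast h1
      refine h2.trans (sum_le_sum fun p hp => ?_)
      obtain ⟨hA, hB, hne⟩ := mem_offDiag.1 hp
      have h3 : (univ.filter fun v : Fin m → ι => p.1 ∘ v = p.2 ∘ v) =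
          Fintype.piFinset fun _ : Fin m => univ.filter fun i => p.1 i = p.2 i := by
        ext v
        simp [funext_iff, Fintype.mem_piFinset]
      have h4 : (#(univ.filter fun i => p.1 i = p.2 i) : ℝ) ≤ N * Real.exp (-ε) := by
        have h5 := card_filter_add_card_filter_not (s := (univ : Finset ι)) fun i => p.1 i = p.2 i
        have h6 : (#(univ.filter fun i => p.1 i = p.2 i) : ℝ) +
            #(univ.filter fun i => p.1 i ≠ p.2 i) = N := by exact_mod_cast h5
        have h7 := hsep _ hA _ hB hne
        have h8 := Real.add_one_le_exp (-ε)
        nlinarith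
      rw [h3, Fintype.card_piFinset]
      simp only [prod_const, card_univ, Fintype.card_fin]
      push_cast
      calc _ ≤ ((N : ℝ) * Real.exp (-ε)) ^ m := by gcongr
        _ = (N : ℝ) ^ m * Real.exp (-(ε * m)) := by
          rw [mul_pow, ← Real.exp_nat_mul]; ring_nf
        _ ≤ (N : ℝ) ^ m * (1 / (k : ℝ) ^ 2) := by
          gcongr
          rw [one_div, ← Real.exp_log (pow_pos hkpos 2), ← Real.exp_neg, Real.exp_le_exp,
            Real.log_pow]
          have := (div_le_iff₀ hε).1 hmlow
          push_cast
          linarith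
    rw [sum_const, offDiag_card, nsmul_eq_mul] at hcard
    have hNm : (0 : ℝ) < (N : ℝ) ^ m := by positivity
    have h9 : (((k * k - k : ℕ) : ℝ)) = k * k - k := by
      rw [Nat.cast_sub (Nat.le_mul_self k)]; push_cast; ring
    change (N : ℝ) ^ m ≤ ((k * k - k : ℕ) : ℝ) * _ at hcard
    rw [h9] at hcard
    have h10 : ((k : ℝ) * k - k) * ((N : ℝ) ^ m * (1 / (k : ℝ) ^ 2)) =
        (N : ℝ) ^ m - (N : ℝ) ^ m / k := by
      field_simp
    have : 0 < (N : ℝ) ^ m / k := by positivity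
    linarith
  obtain ⟨v, hv⟩ := hv
  have hvc : HasVC ((M.image fun A => A ∘ v : Finset (Fin m → Bool)) : Set (Fin m → Bool)) d := by
    rw [coe_image]
    exact hM.comp v
  -- With `x = ε / 4` the exponent is at most `log k / 2 + 1 / 4`, so half of `log k` is absorbed by
  -- the left side.
  have hS := pow_mul_card_le_exp hvc (x := ε / 4) (by positivity) (by linarith)
  rw [card_image_of_injOn hv, Fintype.card_fin] at hS
  have hlog := Real.log_le_log (by positivity) hS
  rw [Real.log_exp, Real.log_mul (by positivity) (by positivity), Real.log_pow] at hlog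
  have hinv : Real.log (ε / 4) = - Real.log (4 / ε) := by rw [← Real.log_inv, inv_div]
  rw [hinv] at hlog
  have h11 : ε / 4 * m ≤ Real.log k / 2 + 1 / 4 := by
    calc ε / 4 * m ≤ ε / 4 * (2 * Real.log k / ε + 1) := by gcongr
      _ = Real.log k / 2 + ε / 4 := by field_simp; ring
      _ ≤ _ := by linarith
  linarith

/-- A separated subset of maximal cardinality is a net: a point far from all its members could be
added. -/
lemma exists_net (𝒜 : Finset (ι → Bool)) {r : ℝ} (hr : 0 ≤ r) :
    ∃ M ⊆ 𝒜, (∀ A ∈ M, ∀ B ∈ M, A ≠ B → r < #{i | A i ≠ B i}) ∧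
      ∀ A ∈ 𝒜, ∃ B ∈ M, (#{i | A i ≠ B i} : ℝ) ≤ r := by
  classical
  let T := 𝒜.powerset.filter fun M => ∀ A ∈ M, ∀ B ∈ M, A ≠ B → r < #{i | A i ≠ B i}
  have hT : T.Nonempty := ⟨∅, by simp [T]⟩
  obtain ⟨M, hM, hmax⟩ := exists_max_image T card hT
  simp only [T, mem_filter, mem_powerset] at hM hmax
  refine ⟨M, hM.1, hM.2, fun A hA => ?_⟩
  by_contra! hcon
  have hAM : A ∉ M := fun h => by
    have := hcon A h
    simp at this
    linarith
  have := hmax (insert A M) ⟨insert_subset hA hM.1, ?_⟩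
  · rw [card_insert_of_notMem hAM] at this
    omega
  · intro B hB B' hB' hne
    rcases mem_insert.1 hB with rfl | hBM
    · rcases mem_insert.1 hB' with rfl | hB'
      · exact absurd rfl hne
      · exact hcon _ hB'
    · rcases mem_insert.1 hB' with rfl | hB'
      · simpa only [ne_comm] using hcon _ hBM
      · exact hM.2 _ hBM _ hB' hne

end Sauer

/-- The sign `±1` encoded by a Boolean. -/
def sgn (b : Bool) : ℝ := if b then 1 else -1

/-- The numerical value `0` or `1` of a Boolean. -/
def bval (b : Bool) : ℝ := if b then 1 else 0

/-! ### Rademacher complexity of VC classes by chaining. -/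

section Rademacher

open Finset

lemma sum_sq_bval_sub {ι : Type*} [Fintype ι] (A B : ι → Bool) :
    ∑ i, (bval (B i) - bval (A i)) ^ 2 = #{i | A i ≠ B i} := by
  rw [card_filter]
  push_cast
  refine sum_congr rfl fun i _ => ?_
  cases A i <;> cases B i <;> simp [bval]

lemma card_ne_triangle {ι : Type*} [Fintype ι] (A B C : ι → Bool) :
    (#{i | A i ≠ C i} : ℝ) ≤ #{i | B i ≠ A i} + #{i | B i ≠ C i} := by
  classical
  have : (univ.filter fun i => A i ≠ C i) ⊆
      (univ.filter fun i => B i ≠ A i) ∪ univ.filter fun i => B i ≠ C i := by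
    intro i
    simp only [mem_filter, mem_univ, true_and, mem_union]
    intro h
    by_contra! h2
    exact h (h2.1.symm.trans h2.2)
  exact_mod_cast (card_le_card this).trans (card_union_le _ _)

variable {ι : Type*} [Fintype ι] [DecidableEq ι] {d : ℕ}

/-- The sum factors over coordinates, and `cosh t ≤ exp (t ^ 2 / 2)`. -/
lemma sum_exp_rademacher_le (a : ι → ℝ) (l : ℝ) :
    ∑ s : ι → Bool, Real.exp (l * ∑ i, a i * sgn (s i)) ≤
      2 ^ Fintype.card ι * Real.exp (l ^ 2 * (∑ i, a i ^ 2) / 2) := by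
  have h1 : ∀ s : ι → Bool, Real.exp (l * ∑ i, a i * sgn (s i)) =
      ∏ i, Real.exp (l * (a i * sgn (s i))) := fun s => by rw [mul_sum, Real.exp_sum]
  simp_rw [h1]
  rw [← Fintype.prod_sum (fun i b => Real.exp (l * (a i * sgn b)))]
  calc ∏ i, ∑ b, Real.exp (l * (a i * sgn b)) ≤ ∏ i, (2 * Real.exp ((l * a i) ^ 2 / 2)) := by
        refine prod_le_prod (fun i _ => by positivity) fun i _ => ?_
        have := Real.cosh_le_exp_half_sq (l * a i)
        rw [Real.cosh_eq] at this
        simp only [Fintype.sum_bool, sgn, if_true, mul_one, mul_neg, Bool.false_eq_true, if_false]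
        linarith
    _ = _ := by
        rw [prod_mul_distrib, prod_const, card_univ, ← Real.exp_sum, mul_sum, sum_div]
        simp_rw [mul_pow]

/-- The average over signs of a maximum over finitely many Rademacher sums. -/
lemma sum_rademacher_choice_le {β : Type*} (I : Finset β) (a : β → ι → ℝ) {v l : ℝ} (hl : 0 < l)
    (ha : ∀ p ∈ I, ∑ i, a p i ^ 2 ≤ v) (p : (ι → Bool) → β) (hp : ∀ s, p s ∈ I) :
    ∑ s : ι → Bool, ∑ i, a (p s) i * sgn (s i) ≤
      2 ^ Fintype.card ι * ((Real.log #I + l ^ 2 * v / 2) / l) := by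
  set c := Real.log #I + l ^ 2 * v / 2
  have hI : (0 : ℝ) < #I := by exact_mod_cast card_pos.2 ⟨_, hp fun _ => true⟩
  -- The tangent inequality `y ≤ c - 1 + exp (y - c)` plays the part of Jensen; `c` is chosen so
  -- that the exponential term averages to at most `1`.
  have h1 : ∀ s : ι → Bool, l * ∑ i, a (p s) i * sgn (s i) ≤
      c - 1 + Real.exp (-c) * ∑ q ∈ I, Real.exp (l * ∑ i, a q i * sgn (s i)) := by
    intro s
    have h2 := Real.add_one_le_exp (l * (∑ i, a (p s) i * sgn (s i)) - c)
    have h3 : Real.exp (l * ∑ i, a (p s) i * sgn (s i)) ≤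
        ∑ q ∈ I, Real.exp (l * ∑ i, a q i * sgn (s i)) :=
      single_le_sum (f := fun q => Real.exp (l * ∑ i, a q i * sgn (s i)))
        (fun _ _ => by positivity) (hp s)
    have h4 : Real.exp (l * (∑ i, a (p s) i * sgn (s i)) - c) ≤
        Real.exp (-c) * ∑ q ∈ I, Real.exp (l * ∑ i, a q i * sgn (s i)) := by
      rw [sub_eq_add_neg, Real.exp_add, mul_comm]
      gcongr
    linarith
  have h5 : l * ∑ s : ι → Bool, ∑ i, a (p s) i * sgn (s i) ≤ 2 ^ Fintype.card ι * c := by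
    rw [mul_sum]
    refine (sum_le_sum fun s _ => h1 s).trans ?_
    rw [sum_add_distrib, ← mul_sum, sum_comm]
    have h6 : ∑ q ∈ I, ∑ s : ι → Bool, Real.exp (l * ∑ i, a q i * sgn (s i)) ≤
        #I * (2 ^ Fintype.card ι * Real.exp (l ^ 2 * v / 2)) := by
      rw [← nsmul_eq_mul]
      refine sum_le_card_nsmul _ _ _ fun q hq => (sum_exp_rademacher_le _ _).trans ?_
      gcongr
      exact ha q hq
    have h7 : Real.exp (-c) * (#I * (2 ^ Fintype.card ι * Real.exp (l ^ 2 * v / 2))) =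
        2 ^ Fintype.card ι := by
      have : Real.exp (-c) * (#I * Real.exp (l ^ 2 * v / 2)) = 1 := by
        nth_rw 1 [← Real.exp_log hI]
        rw [← Real.exp_add, ← Real.exp_add, Real.exp_eq_one_iff]
        simp [c]
      calc _ = 2 ^ Fintype.card ι * (Real.exp (-c) * (#I * Real.exp (l ^ 2 * v / 2))) := by ring
        _ = _ := by rw [this, mul_one]
    have h8 := mul_le_mul_of_nonneg_left h6 (Real.exp_pos (-c)).le
    rw [h7] at h8
    simp only [sum_const, card_univ, Fintype.card_pi, Fintype.card_bool, prod_const,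
      nsmul_eq_mul] at *
    push_cast
    linarith
  rw [← mul_div_assoc, le_div_iff₀ hl]
  linarith

/-- **Dudley's bound**: the Rademacher complexity of a VC class is of order `√(d N)`. -/
theorem sum_rademacher_le (𝒜 : Finset (ι → Bool)) (hd : 1 ≤ d)
    (h𝒜 : HasVC (𝒜 : Set (ι → Bool)) d) (A : (ι → Bool) → ι → Bool) (hA : ∀ s, A s ∈ 𝒜) :
    ∑ s : ι → Bool, ∑ i, bval (A s i) * sgn (s i) ≤
      2 ^ Fintype.card ι * (25 * Real.sqrt (d * Fintype.card ι)) := by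
  classical
  rcases Nat.eq_zero_or_pos (Fintype.card ι) with h0 | hN
  · have : IsEmpty ι := Fintype.card_eq_zero_iff.1 h0
    simp
  set N := Fintype.card ι
  have hNr : (0 : ℝ) < N := by exact_mod_cast hN
  have hdr : (1 : ℝ) ≤ d := by exact_mod_cast hd
  have hr : ∀ j : ℕ, (0 : ℝ) ≤ (1 / 4) ^ j * N := fun j => by positivity
  -- Hamming radius `N / 4 ^ j` is `L²` scale `2 ^ (-j)`, so the increments of the chain decay
  -- geometrically.
  choose M hM𝒜 hsep hnet using fun j => exists_net 𝒜 (hr j)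
  choose! π hπM hπ using hnet
  have hlog : ∀ j, Real.log #(M j) ≤ 4 * d * (j + 1) := by
    intro j
    have h1 := log_card_le_of_separated (h𝒜.mono (by exact_mod_cast hM𝒜 j))
      (ε := (1 / 4) ^ j) (by positivity) (pow_le_one₀ (by norm_num) (by norm_num)) (hsep j)
    have h2 : (4 : ℝ) / (1 / 4) ^ j = 4 ^ (j + 1) := by
      rw [one_div, inv_pow, div_inv_eq_mul]; ring
    have h3 : Real.log 4 ≤ 1.4 := by
      have : (4 : ℝ) = 2 ^ 2 := by norm_num
      rw [this, Real.log_pow]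
      have := Real.log_two_lt_d9
      push_cast
      linarith
    rw [h2, Real.log_pow] at h1
    push_cast at h1
    have h4 : (d : ℝ) * ((j + 1) * Real.log 4) ≤ d * ((j + 1) * 1.4) := by gcongr
    have h5 : (0 : ℝ) ≤ d * j := by positivity
    nlinarith
  have hpos : ∀ j, (0 : ℝ) < #(M j) := fun j => by
    exact_mod_cast card_pos.2 ⟨_, hπM j _ (hA fun _ => true)⟩
  set D := Real.sqrt (d / N)
  set R := Real.sqrt (d * N)
  have hD : 0 < D := Real.sqrt_pos.2 (by positivity)
  have hDN : D * N = R := by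
    rw [← Real.sqrt_sq hNr.le, ← Real.sqrt_mul (by positivity)]
    congr 1
    field_simp
  have hdD : d / D = R := by
    rw [div_eq_iff hD.ne', ← Real.sqrt_mul (by positivity)]
    rw [show (d * N * (d / N) : ℝ) = d ^ 2 by field_simp, Real.sqrt_sq (by positivity)]
  obtain ⟨J, hJ⟩ := exists_pow_lt_of_lt_one (y := (1 / 4 : ℝ)) (x := (1 / N : ℝ)) (by positivity)
    (by norm_num)
  -- At level `J` the radius is below one coordinate, so the chain ends at the function itself.
  have hJid : ∀ B ∈ 𝒜, π J B = B := by
    intro B hB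
    have h1 := hπ J B hB
    have h2 : (1 / 4 : ℝ) ^ J * N < 1 := by rwa [lt_div_iff₀ hNr] at hJ
    have h3 : #{i | B i ≠ π J B i} = 0 := by
      have : (#{i | B i ≠ π J B i} : ℝ) < 1 := lt_of_le_of_lt h1 h2
      exact_mod_cast Nat.lt_one_iff.1 (by exact_mod_cast this)
    rw [card_eq_zero, filter_eq_empty_iff] at h3
    funext i
    have := h3 (mem_univ i)
    push Not at this
    exact this.symm
  have htel : ∀ s, ∑ i, bval (A s i) * sgn (s i) = (∑ i, bval (π 0 (A s) i) * sgn (s i)) +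
      ∑ j ∈ range J, ∑ i, (bval (π (j + 1) (A s) i) - bval (π j (A s) i)) * sgn (s i) := by
    intro s
    have := sum_range_sub (fun j => ∑ i, bval (π j (A s) i) * sgn (s i)) J
    simp only [← sum_sub_distrib, ← sub_mul] at this
    rw [this, hJid _ (hA s)]
    simp_rw [sub_mul]
    rw [sum_sub_distrib]
    ring
  have hbase : ∑ s : ι → Bool, ∑ i, bval (π 0 (A s) i) * sgn (s i) ≤ 2 ^ N * R := by
    refine (sum_rademacher_choice_le (M 0) (fun B i => bval (B i)) (v := N) hD
      (fun B _ => ?_) (fun s => π 0 (A s)) fun s => hπM 0 _ (hA s)).trans ?_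
    · calc ∑ i, bval (B i) ^ 2 ≤ ∑ i : ι, (1 : ℝ) :=
            sum_le_sum fun i _ => by cases B i <;> simp [bval]
        _ = N := by simp [N]
    · have h1 : #(M 0) ≤ 1 := by
        refine card_le_one.2 fun B hB B' hB' => ?_
        by_contra hne
        have h2 := hsep 0 B hB B' hB' hne
        have h3 : #{i | B i ≠ B' i} ≤ N := card_le_univ _
        have h4 : (#{i | B i ≠ B' i} : ℝ) ≤ N := by exact_mod_cast h3
        simp only [pow_zero, one_mul] at h2
        linarith
      have h5 : Real.log #(M 0) ≤ 0 := Real.log_nonpos (by positivity) (by exact_mod_cast h1)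
      gcongr
      rw [div_le_iff₀ hD, ← hDN]
      have : 0 < D * D * N := by positivity
      nlinarith
  -- The parameter `l = 2 ^ (j + 1) * D` balances log-cardinality `O(d (j + 1))` against variance `2
  -- N / 4 ^ j`. Summed over `j` the levels give `24`, and the base level adds `1` to make `25`.
  have hlevel : ∀ j, ∑ s : ι → Bool,
      ∑ i, (bval (π (j + 1) (A s) i) - bval (π j (A s) i)) * sgn (s i) ≤
      2 ^ N * (R * ((4 * j + 8) * (1 / 2) ^ j)) := by
    intro j
    refine (sum_rademacher_choice_le
      ((M j ×ˢ M (j + 1)).filter fun p => ∑ i, (bval (p.2 i) - bval (p.1 i)) ^ 2 ≤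
        2 * (1 / 4) ^ j * N)
      (fun p i => bval (p.2 i) - bval (p.1 i)) (v := 2 * (1 / 4) ^ j * N)
      (l := 2 ^ j * (2 * D)) (by positivity)
      (fun p hp => (mem_filter.1 hp).2) (fun s => (π j (A s), π (j + 1) (A s))) fun s => ?_).trans ?_
    · refine mem_filter.2 ⟨mem_product.2 ⟨hπM j _ (hA s), hπM (j + 1) _ (hA s)⟩, ?_⟩
      dsimp only
      rw [sum_sq_bval_sub]
      refine (card_ne_triangle _ (A s) _).trans ((add_le_add (hπ j _ (hA s))
        (hπ (j + 1) _ (hA s))).trans ?_)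
      have : (0 : ℝ) ≤ (1 / 4) ^ j * N := by positivity
      rw [pow_succ]
      nlinarith
    · set I := (M j ×ˢ M (j + 1)).filter fun p => ∑ i, (bval (p.2 i) - bval (p.1 i)) ^ 2 ≤
        2 * (1 / 4) ^ j * N
      have h1 : Real.log #I ≤ 4 * d * (2 * j + 3) := by
        rcases Nat.eq_zero_or_pos #I with h | h
        · rw [h]
          simp only [Nat.cast_zero, Real.log_zero]
          positivity
        · have h2 : (#I : ℝ) ≤ #(M j) * #(M (j + 1)) := by
            have : #I ≤ #(M j) * #(M (j + 1)) := by
              rw [← card_product]; exact card_filter_le _ _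
            exact_mod_cast this
          have h3 := Real.log_le_log (by exact_mod_cast h) h2
          rw [Real.log_mul (hpos j).ne' (hpos (j + 1)).ne'] at h3
          have h4 := hlog j
          have h5 := hlog (j + 1)
          push_cast at h5
          linarith
      gcongr
      have h6 : (2 : ℝ) ^ j * (1 / 2) ^ j = 1 := by rw [← mul_pow]; norm_num
      have h7 : ((2 : ℝ) ^ j) ^ 2 * (1 / 4) ^ j = 1 := by
        rw [← pow_mul, mul_comm j 2, pow_mul, ← mul_pow]; norm_num
      rw [div_le_iff₀ (by positivity)]
      have h8 : R * ((4 * j + 8) * (1 / 2) ^ j) * (2 ^ j * (2 * D)) =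
          2 * (4 * j + 8) * (R * D) * (2 ^ j * (1 / 2) ^ j) := by ring
      have h9 : (2 ^ j * (2 * D)) ^ 2 * (2 * (1 / 4) ^ j * N) / 2 =
          4 * (D * N * D) * ((2 ^ j) ^ 2 * (1 / 4) ^ j) := by ring
      have h10 : (d : ℝ) = R * D := by rw [← hdD]; field_simp
      rw [h8, h9, h6, h7, hDN, ← h10]
      nlinarith
  have hgeo : ∀ J : ℕ, ∑ j ∈ range J, ((4 * j + 8) * (1 / 2) ^ j : ℝ) =
      24 - (8 * J + 24) * (1 / 2) ^ J := by
    intro J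
    induction J with
    | zero => simp
    | succ J ih => rw [sum_range_succ, ih]; push_cast; ring
  simp_rw [htel]
  rw [sum_add_distrib]
  have hsum : ∑ j ∈ range J, ∑ s : ι → Bool,
      ∑ i, (bval (π (j + 1) (A s) i) - bval (π j (A s) i)) * sgn (s i) ≤
      2 ^ N * (R * 24) := by
    refine (sum_le_sum fun j _ => hlevel j).trans ?_
    rw [← mul_sum, ← mul_sum, hgeo]
    have : (0 : ℝ) ≤ (8 * J + 24) * (1 / 2) ^ J := by positivity
    gcongr
    linarith
  rw [sum_comm] at hsum
  linarith

end Rademacher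

lemma integrable_of_bounded {Ω : Type*} [MeasurableSpace Ω] [DiscreteMeasurableSpace Ω]
    {μ : Measure Ω} [IsFiniteMeasure μ] {F : Ω → ℝ} (B : ℝ) (h : ∀ ω, |F ω| ≤ B) :
    Integrable F μ :=
  .of_bound Measurable.of_discrete.aestronglyMeasurable B (.of_forall h)

/-! ### Symmetrization with a ghost sample. -/

section Symmetrization

variable {Z : Type*} {n : ℕ}

/-- Exchange the `i`-th points of two samples for every `i` with `s i = true`. -/
def swapSamples (s : Fin n → Bool) (w : (Fin n → Z) × (Fin n → Z)) :
    (Fin n → Z) × (Fin n → Z) :=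
  (fun i => if s i then w.2 i else w.1 i, fun i => if s i then w.1 i else w.2 i)

/-- Two independent samples form one sample of independent pairs, and exchanging the entries of a
pair preserves `ν.prod ν`. -/
lemma measurePreserving_swapSamples [MeasurableSpace Z] (ν : Measure Z) [IsProbabilityMeasure ν]
    (s : Fin n → Bool) :
    MeasurePreserving (swapSamples (Z := Z) s)
      ((Measure.pi fun _ => ν).prod (Measure.pi fun _ => ν))
      ((Measure.pi fun _ => ν).prod (Measure.pi fun _ => ν)) := by
  have h1 := measurePreserving_arrowProdEquivProdArrow Z Z (Fin n) (fun _ => ν) (fun _ => ν)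
  have h2 : MeasurePreserving
      (fun (a : Fin n → Z × Z) i => (if s i then Prod.swap else id : Z × Z → Z × Z) (a i))
      (Measure.pi fun _ => ν.prod ν) (Measure.pi fun _ => ν.prod ν) := by
    refine measurePreserving_pi _ _ fun i => ?_
    cases s i
    · exact MeasurePreserving.id _
    · exact Measure.measurePreserving_swap
  have h3 := h1.comp (h2.comp (h1.symm _))
  convert h3 using 1
  funext w
  refine Prod.ext (funext fun i => ?_) (funext fun i => ?_)
  all_goals
    cases h : s i <;>
    simp [swapSamples, h, MeasurableEquiv.arrowProdEquivProdArrow, Equiv.arrowProdEquivProdArrow]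

/-- **Symmetrization**: if the average of `F` over all exchanges of two independent samples is
everywhere at most `G`, then so is its integral. -/
lemma integral_le_of_sum_swapSamples_le [MeasurableSpace Z] {ν : Measure Z} [IsProbabilityMeasure ν]
    {F : (Fin n → Z) × (Fin n → Z) → ℝ} {G : ℝ}
    (hF : Integrable F ((Measure.pi fun _ => ν).prod (Measure.pi fun _ => ν)))
    (h : ∀ w, ∑ s, F (swapSamples s w) ≤ 2 ^ n * G) :
    ∫ w, F w ∂((Measure.pi fun _ => ν).prod (Measure.pi fun _ => ν)) ≤ G := by
  set μ := (Measure.pi fun _ : Fin n => ν).prod (Measure.pi fun _ : Fin n => ν)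
  have hs : ∀ s, ∫ w, F (swapSamples s w) ∂μ = ∫ w, F w ∂μ := by
    intro s
    have hp := measurePreserving_swapSamples (n := n) ν s
    have := integral_map (μ := μ) hp.measurable.aemeasurable (f := F)
      (by rw [hp.map_eq]; exact hF.aestronglyMeasurable)
    rw [← this, hp.map_eq]
  have hi : ∀ s, Integrable (fun w => F (swapSamples s w)) μ := fun s =>
    (measurePreserving_swapSamples ν s).integrable_comp_of_integrable hF
  have h1 : ∫ w, ∑ s, F (swapSamples s w) ∂μ ≤ ∫ _, 2 ^ n * G ∂μ :=
    integral_mono (integrable_finsetSum _ fun s _ => hi s) (integrable_const _) h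
  rw [integral_finsetSum _ fun s _ => hi s] at h1
  simp only [hs, Finset.sum_const, Finset.card_univ, Fintype.card_pi, Fintype.card_bool,
    Finset.prod_const, Fintype.card_fin, nsmul_eq_mul, integral_const, probReal_univ, one_smul] at h1
  push_cast at h1
  exact le_of_mul_le_mul_left h1 (by positivity)

end Symmetrization

/-! ### Expected deviation over a VC class. -/

section UniformDeviation

open Finset

variable {Z : Type*} [Countable Z] [MeasurableSpace Z] [MeasurableSingletonClass Z]
  {ν : Measure Z} [IsProbabilityMeasure ν] {n d : ℕ}

lemma integral_pi_eval (g : Z → ℝ) (i : Fin n) :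
    ∫ ω, g (ω i) ∂(Measure.pi fun _ : Fin n => ν) = ∫ z, g z ∂ν :=
  integral_comp_eval (μ := fun _ : Fin n => ν) Measurable.of_discrete.aestronglyMeasurable

lemma abs_bval_le (b : Bool) : |bval b| ≤ 1 := by cases b <;> simp [bval]

lemma sum_rademacher_trace_le {Z : Type*} {G : Set (Z → Bool)} (hd : 1 ≤ d) (hG : HasVC G d)
    (z : Fin n → Z) (A : (Fin n → Bool) → Z → Bool) (hA : ∀ s, A s ∈ G) :
    ∑ s : Fin n → Bool, ∑ i, bval (A s (z i)) * sgn (s i) ≤ 2 ^ n * (25 * Real.sqrt (d * n)) := by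
  classical
  have := sum_rademacher_le (((fun c => c ∘ z) '' G).toFinite.toFinset) hd
    (by simpa using hG.comp z) (fun s => A s ∘ z) (fun s => by simpa using ⟨_, hA s, rfl⟩)
  simpa using this

/-- The difference splits into Rademacher sums over the points of `w.1` and of `w.2`, the latter
with opposite signs, which complementing `s` repairs. The chosen function depends on `s`, as the
Rademacher bound permits. -/
lemma sum_swapSamples_rademacher_le {Z : Type*} {G : Set (Z → Bool)} (hd : 1 ≤ d)
    (hG : HasVC G d) (A : (Fin n → Z) → Z → Bool) (hA : ∀ ω, A ω ∈ G)
    (w : (Fin n → Z) × (Fin n → Z)) :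
    ∑ s, ∑ i, (bval (A (swapSamples s w).1 ((swapSamples s w).2 i)) -
      bval (A (swapSamples s w).1 ((swapSamples s w).1 i))) ≤
      2 ^ n * (50 * Real.sqrt (d * n)) := by
  have h1 : ∀ s, ∑ i, (bval (A (swapSamples s w).1 ((swapSamples s w).2 i)) -
      bval (A (swapSamples s w).1 ((swapSamples s w).1 i))) =
      (∑ i, bval (A (swapSamples s w).1 (w.1 i)) * sgn (s i)) +
        ∑ i, bval (A (swapSamples s w).1 (w.2 i)) * sgn (!(s i)) := by
    intro s
    rw [← sum_add_distrib]
    refine sum_congr rfl fun i _ => ?_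
    generalize A (swapSamples s w).1 = a
    cases h : s i <;> simp [swapSamples, h, sgn] <;> ring
  simp_rw [h1]
  rw [sum_add_distrib]
  have h2 := sum_rademacher_trace_le hd hG w.1 (fun s => A (swapSamples s w).1) fun s => hA _
  have h3 := sum_rademacher_trace_le hd hG w.2
    (fun s => A (swapSamples (fun i => !(s i)) w).1) fun s => hA _
  have h4 : ∑ s : Fin n → Bool, ∑ i, bval (A (swapSamples s w).1 (w.2 i)) * sgn (!(s i)) =
      ∑ s : Fin n → Bool,
        ∑ i, bval (A (swapSamples (fun i => !(s i)) w).1 (w.2 i)) * sgn (s i) := by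
    rw [← Equiv.sum_comp (Equiv.piCongrRight fun _ : Fin n => Equiv.boolNot)]
    refine sum_congr rfl fun s _ => sum_congr rfl fun i _ => ?_
    have : Equiv.piCongrRight (fun _ : Fin n => Equiv.boolNot) s = fun i => !(s i) := rfl
    simp [this]
  rw [h4]
  linarith

/-- In expectation, the true mean of a member of a VC class that is chosen from a sample exceeds
the mean over the sample by at most `O(√(d / n))`. -/
theorem integral_sub_empirical_le {G : Set (Z → Bool)} (hd : 1 ≤ d) (hG : HasVC G d) (hn : 0 < n)
    (A : (Fin n → Z) → Z → Bool) (hA : ∀ ω, A ω ∈ G) :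
    ∫ ω, ((∫ z, bval (A ω z) ∂ν) - (∑ i, bval (A ω (ω i))) / n) ∂(Measure.pi fun _ : Fin n => ν) ≤
      50 * Real.sqrt (d / n) := by
  have hnr : (0 : ℝ) < n := by exact_mod_cast hn
  set μ := Measure.pi fun _ : Fin n => ν
  -- The true mean is replaced by the mean over the independent sample `w.2`; integrating `w.2` out
  -- gives it back.
  set F : (Fin n → Z) × (Fin n → Z) → ℝ :=
    fun w => (∑ i, (bval (A w.1 (w.2 i)) - bval (A w.1 (w.1 i)))) / n
  have hbd : ∀ w, |F w| ≤ (∑ i : Fin n, (2 : ℝ)) / n := by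
    intro w
    rw [abs_div, abs_of_pos hnr]
    gcongr
    refine (abs_sum_le_sum_abs _ _).trans (sum_le_sum fun i _ => ?_)
    have h1 := abs_le.1 (abs_bval_le (A w.1 (w.2 i)))
    have h2 := abs_le.1 (abs_bval_le (A w.1 (w.1 i)))
    rw [abs_le]
    constructor <;> linarith
  have hF : Integrable F (μ.prod μ) := integrable_of_bounded _ hbd
  have hsym : ∫ w, F w ∂(μ.prod μ) ≤ 50 * Real.sqrt (d / n) := by
    refine integral_le_of_sum_swapSamples_le hF fun w => ?_
    have h1 := sum_swapSamples_rademacher_le hd hG A hA w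
    simp only [F]
    rw [← sum_div, div_le_iff₀ hnr]
    refine h1.trans_eq ?_
    have : Real.sqrt (d / n) * n = Real.sqrt (d * n) := by
      nth_rw 2 [← Real.sqrt_sq hnr.le]
      rw [← Real.sqrt_mul (by positivity)]
      congr 1
      field_simp
    rw [← this]
    ring
  rw [integral_prod _ hF] at hsym
  refine (integral_congr_ae (.of_forall fun ω => ?_)).trans_le hsym
  have hint : ∀ i, Integrable (fun ω' : Fin n → Z => bval (A ω (ω' i))) μ := fun i =>
    integrable_of_bounded 1 fun _ => abs_bval_le _
  simp only [F]
  have hint' : ∀ i, Integrable (fun ω' : Fin n → Z => bval (A ω (ω' i)) - bval (A ω (ω i))) μ :=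
    fun i => (hint i).sub (integrable_const _)
  rw [integral_div, integral_finsetSum _ fun i _ => hint' i]
  have : ∀ i, ∫ ω' : Fin n → Z, (bval (A ω (ω' i)) - bval (A ω (ω i))) ∂μ =
      (∫ z, bval (A ω z) ∂ν) - bval (A ω (ω i)) := by
    intro i
    rw [integral_sub (hint i) (integrable_const _), integral_pi_eval (fun z => bval (A ω z))]
    simp
  simp_rw [this]
  rw [sum_sub_distrib]
  simp only [sum_const, card_univ, Fintype.card_fin, nsmul_eq_mul]
  field_simp

end UniformDeviation

/-! ### Massart noise. -/

section Massart

open ProbabilityTheory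

lemma isProbabilityMeasure_label {X : Type*} [MeasurableSpace X] {f : X → Bool} {ηx : X → ℝ}
    (h : ∀ x, 0 ≤ ηx x ∧ ηx x ≤ 1) (x : X) :
    IsProbabilityMeasure (ENNReal.ofReal (1 - ηx x) • Measure.dirac (x, f x) +
      ENNReal.ofReal (ηx x) • Measure.dirac (x, !(f x))) := by
  constructor
  have h1 := h x
  simp only [Measure.coe_add, Measure.coe_smul, Pi.add_apply, Pi.smul_apply, measure_univ,
    smul_eq_mul, mul_one]
  rw [← ENNReal.ofReal_add (by linarith) h1.1]
  simp

variable {X : Type*} [Countable X] [MeasurableSpace X] [MeasurableSingletonClass X]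
  {P : Measure X} {f : X → Bool} {ηx : X → ℝ}

lemma measurePreserving_fst_massart (h : ∀ x, 0 ≤ ηx x ∧ ηx x ≤ 1) :
    MeasurePreserving Prod.fst (massart P f ηx) P := by
  refine ⟨measurable_fst, Measure.ext fun A hA => ?_⟩
  rw [Measure.map_apply measurable_fst hA, massart,
    Measure.bind_apply (measurable_fst hA) Measurable.of_discrete.aemeasurable,
    ← lintegral_indicator_one hA]
  refine lintegral_congr fun x => ?_
  have h1 := h x
  by_cases hx : x ∈ A
  · simp only [Measure.coe_add, Measure.coe_smul, Pi.add_apply, Pi.smul_apply, smul_eq_mul,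
      Measure.dirac_apply, Set.indicator, Set.mem_preimage, hx, if_true, Pi.one_apply, mul_one]
    rw [← ENNReal.ofReal_add (by linarith) h1.1]
    simp
  · simp [hx]

variable [IsProbabilityMeasure P]

lemma integral_massart (h : ∀ x, 0 ≤ ηx x ∧ ηx x ≤ 1) {g : X × Bool → ℝ} {B : ℝ}
    (hg : ∀ z, |g z| ≤ B) :
    ∫ z, g z ∂(massart P f ηx) = ∫ x, ((1 - ηx x) * g (x, f x) + ηx x * g (x, !(f x))) ∂P := by
  let κ : Kernel X (X × Bool) := ⟨fun x => ENNReal.ofReal (1 - ηx x) • Measure.dirac (x, f x) +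
      ENNReal.ofReal (ηx x) • Measure.dirac (x, !(f x)), Measurable.of_discrete⟩
  have hκ : IsMarkovKernel κ := ⟨isProbabilityMeasure_label h⟩
  have hm : massart P f ηx = (κ ∘ₖ Kernel.const Unit P) () := rfl
  rw [hm, Kernel.integral_comp (integrable_of_bounded B hg)]
  refine integral_congr_ae (.of_forall fun x => ?_)
  have h1 := h x
  change ∫ z, g z ∂(ENNReal.ofReal (1 - ηx x) • Measure.dirac (x, f x) +
      ENNReal.ofReal (ηx x) • Measure.dirac (x, !(f x))) = _
  rw [integral_add_measure, integral_smul_measure, integral_smul_measure, integral_dirac,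
    integral_dirac, ENNReal.toReal_ofReal (by linarith), ENNReal.toReal_ofReal h1.1]
  · simp
  · exact (integrable_of_bounded B hg).smul_measure ENNReal.ofReal_ne_top
  · exact (integrable_of_bounded B hg).smul_measure ENNReal.ofReal_ne_top

lemma isProbabilityMeasure_massart (h : ∀ x, 0 ≤ ηx x ∧ ηx x ≤ 1) :
    IsProbabilityMeasure (massart P f ηx) := by
  constructor
  have := (measurePreserving_fst_massart (P := P) (f := f) h).measure_preimage
    MeasurableSet.univ.nullMeasurableSet
  simpa using this

/-- Under Massart noise, the excess noisy error dominates the distance to the target. -/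
lemma massart_excess_error {η : ℝ} (hη : η < 1 / 2) (h : ∀ x, 0 ≤ ηx x ∧ ηx x ≤ η)
    (c : X → Bool) :
    (1 - 2 * η) * P.real {x | c x ≠ f x} ≤
      (∫ z, bval (Bool.xor (c z.1) z.2) ∂(massart P f ηx)) -
        ∫ z, bval (Bool.xor (f z.1) z.2) ∂(massart P f ηx) := by
  have h1 : ∀ x, 0 ≤ ηx x ∧ ηx x ≤ 1 := fun x => ⟨(h x).1, by linarith [(h x).2]⟩
  rw [integral_massart h1 (fun z => abs_bval_le _), integral_massart h1 (fun z => abs_bval_le _),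
    ← integral_indicator_one MeasurableSet.of_discrete, ← integral_const_mul, ← integral_sub]
  -- Pointwise, where `c` and `f` differ the noisy losses differ by `1 - 2 * ηx x ≥ 1 - 2 * η`;
  -- elsewhere they coincide.
  · refine integral_mono (integrable_of_bounded (1 - 2 * η) fun x => ?_) ?_ fun x => ?_
    · by_cases hx : c x = f x
      · simp [hx]; linarith
      · simp [hx, abs_of_pos (show 0 < 1 - 2 * η by linarith)]
    · refine integrable_of_bounded 4 fun x => ?_
      have := h1 x
      cases c x <;> cases f x <;> simp [bval] <;> rw [abs_le] <;> constructor <;> linarith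
    · have := h x
      by_cases hx : c x = f x
      · simp [hx]
      · have hx' : (!(f x)) = c x := by
          revert hx; cases c x <;> cases f x <;> simp
        have hx'' : f x = !(c x) := by rw [← hx']; simp
        simp [hx'', bval]
        linarith
  all_goals
    refine integrable_of_bounded 2 fun x => ?_
    have := h1 x
    cases c x <;> cases f x <;> simp [bval] <;> rw [abs_le] <;> constructor <;> linarith

end Massart

/-! ### Denoising by empirical risk minimization. -/

section ERM

open Finset

variable {X : Type*} [Countable X] [MeasurableSpace X] [MeasurableSingletonClass X]
  {P : Measure X} [IsProbabilityMeasure P] {f : X → Bool} {ηx : X → ℝ} {C : Set (X → Bool)}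
  {ERM : (m : ℕ) → (Fin m → X) → (Fin m → Bool) → X → Bool} {d N n : ℕ} {η : ℝ}

lemma sum_bval_xor {ι : Type*} [Fintype ι] (a b : ι → Bool) :
    ∑ i, bval (Bool.xor (a i) (b i)) = ({i | a i ≠ b i}.ncard : ℝ) := by
  classical
  rw [Set.ncard_eq_toFinset_card', Set.toFinset_ofPred, card_filter]
  push_cast
  refine sum_congr rfl fun i _ => ?_
  cases a i <;> cases b i <;> simp [bval]

/-- The classifier learned by the oracle from a sample of labeled points. -/
def learned (ERM : (m : ℕ) → (Fin m → X) → (Fin m → Bool) → X → Bool) {m : ℕ}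
    (ω : Fin m → X × Bool) : X → Bool :=
  ERM m (fun i => (ω i).1) fun i => (ω i).2

/-- Because the learned classifier beats `f` on the sample, its excess error is at most its own
true-minus-empirical gap plus the empirical-minus-true gap of `f`. The latter has mean zero since
`f` is fixed, so a one-sided deviation bound suffices. -/
lemma integral_learned_error_le (hd : 1 ≤ d) (hC : HasVC C d) (hERM : IsERM C ERM) (hf : f ∈ C)
    (hη : η < 1 / 2) (h : ∀ x, 0 ≤ ηx x ∧ ηx x ≤ η) (hN : 0 < N) :
    (1 - 2 * η) * ∫ ω, P.real {x | learned ERM ω x ≠ f x}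
      ∂(Measure.pi fun _ : Fin N => massart P f ηx) ≤ 50 * Real.sqrt (d / N) := by
  have := isProbabilityMeasure_massart (P := P) (f := f)
    fun x => ⟨(h x).1, by linarith [(h x).2]⟩
  have hNr : (0 : ℝ) < N := by exact_mod_cast hN
  set ν := massart P f ηx
  set μ := Measure.pi fun _ : Fin N => ν
  let A : (Fin N → X × Bool) → X × Bool → Bool := fun ω z => Bool.xor (learned ERM ω z.1) z.2
  have hG := (hC.comp Prod.fst).xor (Prod.snd : X × Bool → Bool)
  have hmain := integral_sub_empirical_le (ν := ν) hd hG hN A fun ω =>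
    ⟨_, ⟨_, (hERM N _ _).1, rfl⟩, rfl⟩
  have habs : ∀ a : Fin N → Bool, |(∑ i, bval (a i)) / N| ≤ 1 := by
    intro a
    rw [abs_div, abs_of_pos hNr, div_le_one hNr]
    calc _ ≤ ∑ i, |bval (a i)| := abs_sum_le_sum_abs _ _
      _ ≤ ∑ i : Fin N, (1 : ℝ) := sum_le_sum fun i _ => abs_bval_le _
      _ = N := by simp
  have hmean : ∀ a : X × Bool → Bool, |∫ z, bval (a z) ∂ν| ≤ 1 := by
    intro a
    have := norm_integral_le_of_norm_le_const (μ := ν) (f := fun z => bval (a z)) (C := 1)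
      (.of_forall fun z => abs_bval_le _)
    simpa using this
  have hint1 : Integrable (fun ω => (∫ z, bval (A ω z) ∂ν) - (∑ i, bval (A ω (ω i))) / N) μ := by
    refine integrable_of_bounded 2 fun ω => (abs_sub _ _).trans ?_
    linarith [hmean (A ω), habs fun i => A ω (ω i)]
  have hint2 : Integrable
      (fun ω : Fin N → X × Bool => (∑ i, bval (Bool.xor (f (ω i).1) (ω i).2)) / N) μ :=
    integrable_of_bounded 1 fun ω => habs _
  have hint3 : Integrable (fun ω : Fin N → X × Bool =>
      (∑ i, bval (Bool.xor (f (ω i).1) (ω i).2)) / N -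
        ∫ z, bval (Bool.xor (f z.1) z.2) ∂ν) μ := hint2.sub (integrable_const _)
  have hzero : ∫ ω : Fin N → X × Bool, ((∑ i, bval (Bool.xor (f (ω i).1) (ω i).2)) / N -
      ∫ z, bval (Bool.xor (f z.1) z.2) ∂ν) ∂μ = 0 := by
    rw [integral_sub hint2 (integrable_const _), integral_div,
      integral_finsetSum _ fun i _ => integrable_of_bounded 1 fun _ => abs_bval_le _]
    have hi : ∀ i, ∫ ω : Fin N → X × Bool, bval (Bool.xor (f (ω i).1) (ω i).2) ∂μ =
        ∫ z, bval (Bool.xor (f z.1) z.2) ∂ν :=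
      integral_pi_eval fun z : X × Bool => bval (Bool.xor (f z.1) z.2)
    simp_rw [hi]
    simp only [sum_const, card_univ, Fintype.card_fin, nsmul_eq_mul, integral_const,
      probReal_univ, one_smul]
    field_simp
    simp
  rw [← add_zero (∫ ω, _ ∂μ), ← hzero, ← integral_add hint1 hint3]
    at hmain
  rw [← integral_const_mul]
  refine (integral_mono (integrable_of_bounded 1 fun ω => ?_)
    (hint1.add hint3) fun ω => ?_).trans hmain
  · have hη0 : 0 ≤ η := by
      obtain ⟨x⟩ : Nonempty X := P.nonempty_of_neZero
      exact (h x).1.trans (h x).2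
    rw [abs_of_nonneg (mul_nonneg (by linarith) measureReal_nonneg)]
    have h1 : P.real {x | learned ERM ω x ≠ f x} ≤ 1 := measureReal_le_one
    nlinarith [measureReal_nonneg (μ := P) (s := {x | learned ERM ω x ≠ f x})]
  · have h1 := massart_excess_error (P := P) (f := f) hη h (learned ERM ω)
    have h2 : (∑ i, bval (A ω (ω i))) / N ≤
        (∑ i, bval (Bool.xor (f (ω i).1) (ω i).2)) / N := by
      have h3 := (hERM N (fun i => (ω i).1) fun i => (ω i).2).2 f hf
      refine div_le_div_of_nonneg_right ?_ hNr.le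
      simp only [A]
      rw [sum_bval_xor (fun i => learned ERM ω (ω i).1), sum_bval_xor (fun i => f (ω i).1)]
      exact_mod_cast h3
    change (1 - 2 * η) * P.real {x | learned ERM ω x ≠ f x} ≤ (_ - _) + (_ - _)
    simp only [A] at h2 ⊢
    linarith

/-- This covers `d = 0`, where chaining does not apply but the learned classifier must be `f`. -/
lemma HasVC.subsingleton {X : Type*} {C : Set (X → Bool)} (hC : HasVC C 0) : C.Subsingleton := by
  intro c hc c' hc'
  by_contra hne
  obtain ⟨x, hx⟩ := Function.ne_iff.1 hne
  have := hC {x} fun g => by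
    by_cases h : c x = g x
    · exact ⟨c, hc, by simpa using h⟩
    · refine ⟨c', hc', ?_⟩
      have : c' x = g x := by
        revert hx h; cases c x <;> cases c' x <;> cases g x <;> simp
      simpa using this
  simp at this

/-- With `N` noisy examples the learned classifier has expected distance at most `δ / (4 n)` to the
target. -/
lemma mul_integral_learned_error_le (hC : HasVC C d) (hERM : IsERM C ERM) (hf : f ∈ C)
    (hη : η < 1 / 2) (h : ∀ x, 0 ≤ ηx x ∧ ηx x ≤ η) (hn : 1 ≤ n) {δ : ℝ} (hδ : 0 < δ) (hδ1 : δ < 1)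
    (hN : 40000 * ((d * n ^ 2 + Real.logb 2 (2 / δ)) / (δ ^ 2 * (1 - 2 * η) ^ 2)) ≤ N) :
    n * ∫ ω, P.real {x | learned ERM ω x ≠ f x}
      ∂(Measure.pi fun _ : Fin N => massart P f ηx) ≤ δ / 4 := by
  rcases Nat.eq_zero_or_pos d with rfl | hd
  · have : ∀ ω : Fin N → X × Bool, learned ERM ω = f := fun ω =>
      hC.subsingleton (hERM N _ _).1 hf
    simp [this]
    positivity
  have hnr : (1 : ℝ) ≤ n := by exact_mod_cast hn
  have hdr : (1 : ℝ) ≤ d := by exact_mod_cast hd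
  have hh : 0 < 1 - 2 * η := by linarith
  have hlog : 0 ≤ Real.logb 2 (2 / δ) :=
    Real.logb_nonneg one_lt_two (by rw [le_div_iff₀ hδ]; linarith)
  have hN1 : 40000 * (d * n ^ 2 / (δ ^ 2 * (1 - 2 * η) ^ 2)) ≤ N := by
    refine le_trans ?_ hN
    gcongr
    linarith
  have hNr : (0 : ℝ) < N := lt_of_lt_of_le (by positivity) hN1
  have h1 := integral_learned_error_le (P := P) hd hC hERM hf hη h (by exact_mod_cast hNr)
  -- Here `200 = 4 * 50` turns the deviation constant into `δ / (4n)`, and `40000 = 200 ^ 2`.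
  have h2 : Real.sqrt (d / N) ≤ δ * (1 - 2 * η) / (200 * n) := by
    rw [Real.sqrt_le_left (by positivity)]
    rw [div_le_iff₀ hNr]
    rw [← mul_div_assoc, div_le_iff₀ (by positivity)] at hN1
    rw [div_pow, div_mul_eq_mul_div, le_div_iff₀ (by positivity)]
    nlinarith
  have h3 : (1 - 2 * η) * ∫ ω, P.real {x | learned ERM ω x ≠ f x}
      ∂(Measure.pi fun _ : Fin N => massart P f ηx) ≤ (1 - 2 * η) * (δ / 4 / n) := by
    refine h1.trans ?_
    calc _ ≤ 50 * (δ * (1 - 2 * η) / (200 * n)) := by gcongr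
      _ = _ := by field_simp; norm_num
  have h4 := le_of_mul_le_mul_left h3 hh
  rw [le_div_iff₀ (by linarith)] at h4
  linarith

lemma measureReal_prod {Ω Ω' : Type*} [MeasurableSpace Ω] [MeasurableSpace Ω'] {μ : Measure Ω}
    {μ' : Measure Ω'} [IsFiniteMeasure μ] [IsFiniteMeasure μ'] {s : Set (Ω × Ω')}
    (hs : MeasurableSet s) : (μ.prod μ').real s = ∫ x, μ'.real (Prod.mk x ⁻¹' s) ∂μ := by
  rw [measureReal_def, Measure.prod_apply hs]
  exact (integral_toReal (measurable_measure_prodMk_left hs).aemeasurable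
    (.of_forall fun _ => measure_lt_top _ _)).symm

/-- The probability that the learned classifier mislabels some point of a fresh sample. -/
lemma measureReal_exists_learned_ne_le (h : ∀ x, 0 ≤ ηx x ∧ ηx x ≤ 1) :
    ((Measure.pi fun _ : Fin N => massart P f ηx).prod
      (Measure.pi fun _ : Fin n => massart P f ηx)).real
        {w | ∃ i, learned ERM w.1 (w.2 i).1 ≠ f (w.2 i).1} ≤
      n * ∫ ω, P.real {x | learned ERM ω x ≠ f x}
        ∂(Measure.pi fun _ : Fin N => massart P f ηx) := by
  have := isProbabilityMeasure_massart (P := P) (f := f) h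
  rw [measureReal_prod MeasurableSet.of_discrete, ← integral_const_mul]
  refine integral_mono (integrable_of_bounded 1 fun ω => ?_) (integrable_of_bounded n fun ω => ?_)
    fun ω => ?_
  · rw [abs_of_nonneg measureReal_nonneg]
    exact measureReal_le_one
  · rw [abs_of_nonneg (by positivity)]
    exact mul_le_of_le_one_right (by positivity) measureReal_le_one
  · have h1 : (Prod.mk ω ⁻¹' {w : (Fin N → X × Bool) × (Fin n → X × Bool) |
        ∃ i, learned ERM w.1 (w.2 i).1 ≠ f (w.2 i).1}) =
        ⋃ i, {w : Fin n → X × Bool | learned ERM ω (w i).1 ≠ f (w i).1} := by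
      ext; simp
    simp only [h1]
    refine (measureReal_iUnion_fintype_le _).trans ?_
    have h2 : ∀ i, (Measure.pi fun _ : Fin n => massart P f ηx).real
        {w : Fin n → X × Bool | learned ERM ω (w i).1 ≠ f (w i).1} =
        P.real {x | learned ERM ω x ≠ f x} := by
      intro i
      have hp := (measurePreserving_fst_massart (P := P) (f := f) h).comp
        (measurePreserving_eval (fun _ : Fin n => massart P f ηx) i)
      exact congrArg ENNReal.toReal (hp.measure_preimage (s := {x | learned ERM ω x ≠ f x})
        MeasurableSet.of_discrete.nullMeasurableSet)
    simp [h2]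

end ERM

/-! ### Relative deviations for sets determined by several classifiers. -/

section RelativeDeviation

open Finset

variable {X : Type*} {n k d : ℕ} {C : Set (X → Bool)} {a b : ℝ}

/-- The number of sample points in `S`, as a real number. -/
noncomputable def hits (S : Set X) (z : Fin n → X) : ℝ := ∑ i, S.indicator 1 (z i)

lemma indicator_one_eq (S : Set X) (x : X) :
    S.indicator (1 : X → ℝ) x = 0 ∨ S.indicator (1 : X → ℝ) x = 1 := by
  by_cases h : x ∈ S <;> simp [h]

lemma hits_nonneg (S : Set X) (z : Fin n → X) : 0 ≤ hits S z :=
  sum_nonneg fun i _ => by rcases indicator_one_eq S (z i) with h | h <;> simp [h]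

lemma hits_le (S : Set X) (z : Fin n → X) : hits S z ≤ n := by
  calc hits S z ≤ ∑ i : Fin n, (1 : ℝ) :=
        sum_le_sum fun i _ => by rcases indicator_one_eq S (z i) with h | h <;> simp [h]
    _ = n := by simp

lemma hits_eq_ncard (S : Set X) (z : Fin n → X) : hits S z = {i | z i ∈ S}.ncard := by
  classical
  rw [Set.ncard_eq_toFinset_card', Set.toFinset_ofPred, card_filter]
  push_cast
  refine sum_congr rfl fun i _ => ?_
  by_cases h : z i ∈ S <;> simp [h]

/-- The sum factors over the pairs. A pair with both points in `S` contributes `2 * exp (a - b)`,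
with one `exp a + exp (-b)`, with none `2`; each is at most `2`. -/
lemma sum_exp_swapSamples_le (hab : a ≤ b) (h2 : Real.exp a + Real.exp (-b) ≤ 2) (S : Set X)
    (w : (Fin n → X) × (Fin n → X)) :
    ∑ s, Real.exp (a * hits S (swapSamples s w).2 - b * hits S (swapSamples s w).1) ≤ 2 ^ n := by
  have h1 : ∀ s, Real.exp (a * hits S (swapSamples s w).2 - b * hits S (swapSamples s w).1) =
      ∏ i, Real.exp (a * S.indicator 1 (if s i then w.1 i else w.2 i) -
        b * S.indicator 1 (if s i then w.2 i else w.1 i)) := by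
    intro s
    rw [← Real.exp_sum, sum_sub_distrib, ← mul_sum, ← mul_sum]
    rfl
  simp_rw [h1]
  rw [← Fintype.prod_sum (fun (i : Fin n) (c : Bool) =>
    Real.exp (a * S.indicator 1 (if c then w.1 i else w.2 i) -
        b * S.indicator 1 (if c then w.2 i else w.1 i)))]
  calc _ ≤ ∏ i : Fin n, (2 : ℝ) := by
        refine prod_le_prod (fun i _ => sum_nonneg fun _ _ => (Real.exp_pos _).le) fun i _ => ?_
        have h3 : Real.exp (a - b) ≤ 1 := Real.exp_le_one_iff.2 (by linarith)
        simp only [Fintype.sum_bool, if_true, Bool.false_eq_true, if_false]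
        rcases indicator_one_eq S (w.1 i) with h | h <;>
          rcases indicator_one_eq S (w.2 i) with h' | h' <;> simp [h, h'] <;> linarith
    _ = 2 ^ n := by simp

/-- A family of sets, indexed by tuples of classifiers, is local if membership of `x` depends only
on the values at `x` of the classifiers. -/
def IsLocal (B : (Fin k → X → Bool) → Set X) : Prop :=
  ∀ θ θ' x, (∀ j, θ j x = θ' j x) → (x ∈ B θ ↔ x ∈ B θ')

/-- Exchanges do not change the pool of `2n` points, and on the pool a local set depends only on the
traces of its classifiers. So the data-dependent choice is dominated by a sum over at most `(2n + 1)
^ (d * k)` fixed sets. -/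
lemma sum_swapSamples_le_growth (hC : HasVC C d) {B : (Fin k → X → Bool) → Set X} (hB : IsLocal B)
    (hab : a ≤ b) (h2 : Real.exp a + Real.exp (-b) ≤ 2) (Θ : (Fin n → X) → Fin k → X → Bool)
    (E : Set (Fin n → X)) (hΘ : ∀ z ∈ E, ∀ j, Θ z j ∈ C) (w : (Fin n → X) × (Fin n → X)) :
    ∑ s, E.indicator (fun _ => (1 : ℝ)) (swapSamples s w).1 *
      Real.exp (a * hits (B (Θ (swapSamples s w).1)) (swapSamples s w).2 -
        b * hits (B (Θ (swapSamples s w).1)) (swapSamples s w).1) ≤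
      2 ^ n * (2 * n + 1) ^ (d * k) := by
  classical
  let pts : Fin n ⊕ Fin n → X := Sum.elim w.1 w.2
  let T : Finset (Fin n ⊕ Fin n → Bool) := ((fun c => c ∘ pts) '' C).toFinite.toFinset
  have hT : (#T : ℝ) ≤ (2 * n + 1) ^ d := by
    have h1 : HasVC (T : Set (Fin n ⊕ Fin n → Bool)) d := by simpa [T] using hC.comp pts
    have h3 := card_le_pow h1
    rw [Fintype.card_sum, Fintype.card_fin, ← two_mul] at h3
    exact_mod_cast h3
  have hrep : ∀ t ∈ T, ∃ c : X → Bool, c ∘ pts = t := by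
    intro t ht
    obtain ⟨c, -, hc⟩ : t ∈ (fun c => c ∘ pts) '' C := by simpa [T] using ht
    exact ⟨c, hc⟩
  choose! rep hrep using hrep
  let U := Fintype.piFinset fun _ : Fin k => T
  have hU : (#U : ℝ) ≤ (2 * n + 1) ^ (d * k) := by
    have : #U = #T ^ k := by simp [U]
    rw [this, pow_mul]
    push_cast
    gcongr
  have hterm : ∀ s, E.indicator (fun _ => (1 : ℝ)) (swapSamples s w).1 *
      Real.exp (a * hits (B (Θ (swapSamples s w).1)) (swapSamples s w).2 -
        b * hits (B (Θ (swapSamples s w).1)) (swapSamples s w).1) ≤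
      ∑ τ ∈ U, Real.exp (a * hits (B fun j => rep (τ j)) (swapSamples s w).2 -
        b * hits (B fun j => rep (τ j)) (swapSamples s w).1) := by
    intro s
    by_cases hE : (swapSamples s w).1 ∈ E
    swap
    · rw [Set.indicator_of_notMem hE, zero_mul]
      exact sum_nonneg fun _ _ => (Real.exp_pos _).le
    rw [Set.indicator_of_mem hE, one_mul]
    set θ := Θ (swapSamples s w).1
    have hθ : ∀ j, θ j ∘ pts ∈ T := fun j => by
      simpa [T] using ⟨θ j, hΘ _ hE j, rfl⟩
    have hagree : ∀ j q, θ j (pts q) = rep (θ j ∘ pts) (pts q) := fun j q =>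
      (congrFun (hrep _ (hθ j)) q).symm
    have hmem : ∀ q, pts q ∈ B θ ↔ pts q ∈ B fun j => rep (θ j ∘ pts) := fun q =>
      hB _ _ _ fun j => hagree j q
    have h1 : ∀ i, w.1 i ∈ B θ ↔ w.1 i ∈ B fun j => rep (θ j ∘ pts) := fun i => hmem (.inl i)
    have h3 : ∀ i, w.2 i ∈ B θ ↔ w.2 i ∈ B fun j => rep (θ j ∘ pts) := fun i => hmem (.inr i)
    have hh1 : hits (B θ) (swapSamples s w).1 =
        hits (B fun j => rep (θ j ∘ pts)) (swapSamples s w).1 := by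
      refine sum_congr rfl fun i _ => ?_
      simp only [swapSamples, Set.indicator, Pi.one_apply]
      rcases Bool.eq_false_or_eq_true (s i) with h | h <;> simp [h, h1, h3]
    have hh2 : hits (B θ) (swapSamples s w).2 =
        hits (B fun j => rep (θ j ∘ pts)) (swapSamples s w).2 := by
      refine sum_congr rfl fun i _ => ?_
      simp only [swapSamples, Set.indicator, Pi.one_apply]
      rcases Bool.eq_false_or_eq_true (s i) with h | h <;> simp [h, h1, h3]
    rw [hh1, hh2]
    exact single_le_sum (f := fun τ : Fin k → Fin n ⊕ Fin n → Bool =>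
      Real.exp (a * hits (B fun j => rep (τ j)) (swapSamples s w).2 -
        b * hits (B fun j => rep (τ j)) (swapSamples s w).1))
      (fun _ _ => (Real.exp_pos _).le)
      (Fintype.mem_piFinset.2 hθ : (fun j => θ j ∘ pts) ∈ U)
  refine (sum_le_sum fun s _ => hterm s).trans ?_
  rw [sum_comm]
  refine (sum_le_card_nsmul _ _ _ fun τ _ => sum_exp_swapSamples_le hab h2 _ w).trans ?_
  rw [nsmul_eq_mul, mul_comm]
  gcongr

variable [Countable X] [MeasurableSpace X] [MeasurableSingletonClass X]
  {D : Measure X} [IsProbabilityMeasure D]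

/-- Jensen's inequality: it bounds the ghost sample's contribution from below. -/
lemma exp_le_integral_exp_hits (S : Set X) :
    Real.exp (a * (n * D.real S)) ≤
      ∫ z, Real.exp (a * hits S z) ∂(Measure.pi fun _ : Fin n => D) := by
  have hb : ∀ z : Fin n → X, |a * hits S z| ≤ |a| * n := fun z => by
    rw [abs_mul, abs_of_nonneg (hits_nonneg S z)]
    gcongr
    exact hits_le S z
  have h1 : ∫ z, a * hits S z ∂(Measure.pi fun _ : Fin n => D) = a * (n * D.real S) := by
    rw [integral_const_mul]
    simp only [hits]
    rw [integral_finsetSum _ fun i _ => integrable_of_bounded 1 fun z => by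
      rcases indicator_one_eq S (z i) with h | h <;> simp [h]]
    have hi : ∀ i : Fin n, ∫ z : Fin n → X, S.indicator (1 : X → ℝ) (z i)
        ∂(Measure.pi fun _ : Fin n => D) = D.real S := fun i =>
      (integral_pi_eval (S.indicator 1) i).trans (integral_indicator_one .of_discrete)
    simp [hi]
  rw [← h1]
  refine convexOn_exp.map_integral_le Real.continuous_exp.continuousOn isClosed_univ
    (.of_forall fun _ => Set.mem_univ _) (integrable_of_bounded _ hb)
    (integrable_of_bounded (Real.exp (|a| * n)) fun z => ?_)
  simp only [Function.comp, abs_of_pos (Real.exp_pos _), Real.exp_le_exp]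
  exact (le_abs_self _).trans (hb z)

/-- **Relative deviations**: the probability that some set determined by `k` members of a VC class
has large measure but is rarely hit by the sample. -/
theorem measureReal_exists_rarely_hit_le (hC : HasVC C d) {B : (Fin k → X → Bool) → Set X}
    (hB : IsLocal B) (ha : 0 ≤ a) (hab : a ≤ b) (h2 : Real.exp a + Real.exp (-b) ≤ 2) (p r : ℝ) :
    (Measure.pi fun _ : Fin n => D).real
      {z | ∃ θ, (∀ j, θ j ∈ C) ∧ p < D.real (B θ) ∧ hits (B θ) z ≤ r * n} ≤
      (2 * n + 1) ^ (d * k) * Real.exp (-(n * (p * a - r * b))) := by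
  classical
  set μ := Measure.pi fun _ : Fin n => D
  set E := {z : Fin n → X | ∃ θ, (∀ j, θ j ∈ C) ∧ p < D.real (B θ) ∧ hits (B θ) z ≤ r * n}
  have hE : ∀ z : Fin n → X, ∃ θ, z ∈ E →
      (∀ j, θ j ∈ C) ∧ p < D.real (B θ) ∧ hits (B θ) z ≤ r * n := by
    intro z
    by_cases hz : z ∈ E
    · obtain ⟨θ, hθ⟩ := hz
      exact ⟨θ, fun _ => hθ⟩
    · exact ⟨fun _ _ => true, fun h => absurd h hz⟩
  choose Θ hΘ using hE
  -- The witness `Θ w.1` ignores the ghost sample `w.2`. Given a bad `w.1`, the mean of `F` over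
  -- `w.2` is therefore at least `exp (n * (p * a - r * b))`, while symmetrization bounds its total
  -- mean.
  set F : (Fin n → X) × (Fin n → X) → ℝ := fun w => E.indicator (fun _ => (1 : ℝ)) w.1 *
    Real.exp (a * hits (B (Θ w.1)) w.2 - b * hits (B (Θ w.1)) w.1)
  have hind : ∀ z, |E.indicator (fun _ => (1 : ℝ)) z| ≤ 1 := fun z => by
    by_cases h : z ∈ E <;> simp [h]
  have hF : Integrable F (μ.prod μ) := by
    refine integrable_of_bounded (1 * Real.exp (a * n)) fun w => ?_
    rw [abs_mul, abs_of_pos (Real.exp_pos _)]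
    refine mul_le_mul (hind _) (Real.exp_le_exp.2 ?_) (Real.exp_pos _).le zero_le_one
    have h1 := mul_le_mul_of_nonneg_left (hits_le (B (Θ w.1)) w.2) ha
    have h3 := mul_nonneg (ha.trans hab) (hits_nonneg (B (Θ w.1)) w.1)
    linarith
  have hup : ∫ w, F w ∂(μ.prod μ) ≤ (2 * n + 1) ^ (d * k) :=
    integral_le_of_sum_swapSamples_le hF fun w =>
      sum_swapSamples_le_growth hC hB hab h2 Θ E (fun z hz => (hΘ z hz).1) w
  have hlow : Real.exp (n * (p * a - r * b)) * μ.real E ≤ ∫ w, F w ∂(μ.prod μ) := by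
    rw [integral_prod _ hF, ← integral_indicator_one .of_discrete, ← integral_const_mul]
    refine integral_mono (integrable_of_bounded (Real.exp (n * (p * a - r * b))) fun z => ?_)
      hF.integral_prod_left fun z => ?_
    · rw [abs_mul, abs_of_pos (Real.exp_pos _)]
      exact mul_le_of_le_one_right (Real.exp_pos _).le (hind z)
    · by_cases hz : z ∈ E
      · obtain ⟨-, hp, hr⟩ := hΘ z hz
        simp only [F, Set.indicator_of_mem hz, Pi.one_apply, one_mul, mul_one]
        simp_rw [sub_eq_add_neg (a * _), Real.exp_add]
        rw [integral_mul_const]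
        calc Real.exp (n * (p * a - r * b)) ≤
            Real.exp (a * (n * D.real (B (Θ z)))) * Real.exp (-(b * hits (B (Θ z)) z)) := by
              rw [← Real.exp_add, Real.exp_le_exp]
              have h1 := mul_le_mul_of_nonneg_left hr (ha.trans hab)
              have h3 : n * (a * p) ≤ n * (a * D.real (B (Θ z))) := by gcongr
              linarith
          _ ≤ _ := by
              gcongr
              exact exp_le_integral_exp_hits _
      · simp [F, hz]
  rw [Real.exp_neg, ← div_eq_mul_inv, le_div_iff₀ (Real.exp_pos _), mul_comm]
  exact hlow.trans hup

end RelativeDeviation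

/-! ### Runs of Rejectron. -/

section Run

variable {X : Type*} {n : ℕ} {C : Set (X → Bool)}
  {ERM : (m : ℕ) → (Fin m → X) → (Fin m → Bool) → X → Bool}
  {x xt : Fin n → X} {y : Fin n → Bool} {ε : ℝ} {h f : X → Bool} {c : ℕ → X → Bool} {T : ℕ}

lemma hits_mono {S S' : Set X} (hS : S ⊆ S') (z : Fin n → X) : hits S z ≤ hits S' z :=
  Finset.sum_le_sum fun _ _ => Set.indicator_le_indicator_of_subset hS (fun _ => zero_le_one) _

lemma empErr_eq_hits (z : Fin n → X) (h : X → Bool) (S : Set X) (g : X → Bool) :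
    empErr z h S g = hits {u | g u ≠ h u ∧ u ∈ S} z / n := by
  rw [hits_eq_ncard]
  rfl

lemma empErr_nonneg (z : Fin n → X) (h : X → Bool) (S : Set X) (g : X → Bool) :
    0 ≤ empErr z h S g := by
  rw [empErr_eq_hits]
  have := hits_nonneg {u | g u ≠ h u ∧ u ∈ S} z
  positivity

/-- One disagreement on a training point costs at least `(n + 1) / n`, more than any test error can
repay. -/
lemma agree_of_score_pos {S : Set X} {g : X → Bool} (hn : 1 ≤ n)
    (hs : 0 < score x xt (n + 1) h S g) (i : Fin n) : g (x i) = h (x i) := by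
  have hnr : (1 : ℝ) ≤ n := by exact_mod_cast hn
  by_contra hne
  have h1 : 1 ≤ hits {u | g u ≠ h u ∧ u ∈ Set.univ} x := by
    rw [hits_eq_ncard]
    have hi : {i | x i ∈ {u | g u ≠ h u ∧ u ∈ Set.univ}}.Nonempty := ⟨i, hne, trivial⟩
    exact_mod_cast (Set.ncard_pos).2 hi
  have h2 := hits_le {u | g u ≠ h u ∧ u ∈ S} xt
  rw [score, empErr_eq_hits, empErr_eq_hits, ← mul_div_assoc, ← sub_div,
    lt_div_iff₀ (by linarith), zero_mul] at hs
  nlinarith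

lemma agreeSet_succ (h : X → Bool) (c : ℕ → X → Bool) (t : ℕ) :
    agreeSet h c (t + 1) = agreeSet h c t ∩ {u | c t u = h u} := by
  ext u
  simp only [agreeSet, Set.mem_ofPred_eq, Set.mem_inter_iff, Nat.lt_succ_iff_lt_or_eq]
  constructor
  · exact fun hu => ⟨fun i hi => hu i (.inl hi), hu t (.inr rfl)⟩
  · rintro ⟨hu, ht⟩ i (hi | rfl)
    · exact hu i hi
    · exact ht

/-- Every iteration that does not stop removes more than `ε n` test points. -/
lemma hits_agreeSet_le (hn : 1 ≤ n) (hT : ∀ t < T, ε < score x xt (n + 1) h (agreeSet h c t) (c t)) :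
    hits (agreeSet h c T) xt ≤ n - T * ε * n := by
  have hnr : (1 : ℝ) ≤ n := by exact_mod_cast hn
  induction T with
  | zero => simpa using hits_le _ xt
  | succ t ih =>
    have h1 := ih fun s hs => hT s (by omega)
    have h2 : ε * n ≤ hits {u | c t u ≠ h u ∧ u ∈ agreeSet h c t} xt := by
      have h3 := hT t (by omega)
      have h4 := empErr_nonneg x h Set.univ (c t)
      rw [← le_div_iff₀ (by linarith), ← empErr_eq_hits]
      rw [score] at h3
      nlinarith
    have h5 : hits (agreeSet h c (t + 1)) xt + hits {u | c t u ≠ h u ∧ u ∈ agreeSet h c t} xt =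
        hits (agreeSet h c t) xt := by
      rw [hits, hits, hits, ← Finset.sum_add_distrib]
      refine Finset.sum_congr rfl fun i _ => ?_
      rw [agreeSet_succ]
      by_cases h6 : xt i ∈ agreeSet h c t <;> by_cases h7 : c t (xt i) = h (xt i) <;>
        simp [Set.indicator, h6, h7]
    push_cast
    linarith

lemma mul_le_one_of_run (hn : 1 ≤ n)
    (hT : ∀ t < T, ε < score x xt (n + 1) h (agreeSet h c t) (c t)) : T * ε ≤ 1 := by
  have hnr : (1 : ℝ) ≤ n := by exact_mod_cast hn
  have h1 := hits_agreeSet_le hn hT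
  have h2 := hits_nonneg (agreeSet h c T) xt
  by_contra! h3
  nlinarith

lemma exists_score_le (hn : 1 ≤ n) (hε : 0 < ε) (c : ℕ → X → Bool) :
    ∃ T, score x xt (n + 1) h (agreeSet h c T) (c T) ≤ ε := by
  by_contra! hcon
  obtain ⟨T, hT⟩ := exists_nat_gt (1 / ε)
  rw [div_lt_iff₀ hε] at hT
  exact absurd (mul_le_one_of_run (T := T) hn fun t _ => hcon t) (not_le.2 hT)

lemma rejectronTerminates (hn : 1 ≤ n) (hε : 0 < ε) :
    RejectronTerminates C ERM x y xt ε (n + 1) :=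
  fun c _ => exists_score_le hn hε c

/-- The score depends only on the traces on the two samples, of which there are finitely many even
if `C` is infinite. -/
lemma exists_maximizer (hC : C.Nonempty) (L : ℝ) (S : Set X) :
    ∃ g ∈ C, ∀ g' ∈ C, score x xt L h S g' ≤ score x xt L h S g := by
  let φ : (Fin n → Bool) × (Fin n → Bool) → ℝ := fun p =>
    ({i : Fin n | p.2 i ≠ h (xt i) ∧ xt i ∈ S}.ncard : ℝ) / n -
      L * (({i : Fin n | p.1 i ≠ h (x i) ∧ x i ∈ Set.univ}.ncard : ℝ) / n)
  have hφ : ∀ g, score x xt L h S g = φ (g ∘ x, g ∘ xt) := fun g => rfl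
  have hfin : ((fun g : X → Bool => (g ∘ x, g ∘ xt)) '' C).Finite := Set.toFinite _
  obtain ⟨_, ⟨g, hg, rfl⟩, hmax⟩ := Set.exists_max_image _ φ hfin (hC.image _)
  exact ⟨g, hg, fun g' hg' => by rw [hφ, hφ]; exact hmax _ ⟨g', hg', rfl⟩⟩

lemma exists_isRejectronOutput (hC : C.Nonempty) (hn : 1 ≤ n) (hε : 0 < ε) :
    ∃ h S, IsRejectronOutput C ERM x y xt ε (n + 1) h S := by
  classical
  set h := ERM n x y
  choose m hmC hm using exists_maximizer (x := x) (xt := xt) (h := h) hC (n + 1)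
  -- The selection sets are built first, since each `c t` refers to a set made from its
  -- predecessors.
  let St : ℕ → Set X := fun t => Nat.rec Set.univ (fun _ S => S ∩ {u | m S u = h u}) t
  let c : ℕ → X → Bool := fun t => m (St t)
  have hSt : ∀ t, agreeSet h c t = St t := by
    intro t
    induction t with
    | zero => simp [agreeSet, St]
    | succ t ih => rw [agreeSet_succ, ih]
  have hex := exists_score_le (x := x) (xt := xt) (h := h) hn hε c
  refine ⟨h, agreeSet h c (Nat.find hex), rfl, Nat.find hex, c, fun t _ => ⟨hmC _, ?_⟩,
    fun t ht => not_le.1 (Nat.find_min hex ht), Nat.find_spec hex, rfl⟩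
  rw [hSt]
  exact hm _

/-- What is known about an output whose labels come from a target `f` in the class. -/
lemma IsRejectronOutput.spec (hERM : IsERM C ERM) (hf : f ∈ C) (hn : 1 ≤ n) (hε : 0 < ε)
    (hy : ∀ i, f (x i) = y i) {S : Set X}
    (hout : IsRejectronOutput C ERM x y xt ε (n + 1) h S) :
    h ∈ C ∧ ∃ (T : ℕ) (c : ℕ → X → Bool), (∀ t < T, c t ∈ C) ∧ S = agreeSet h c T ∧ T * ε ≤ 1 ∧
      (∀ i, x i ∈ S) ∧ hits S xt ≤ n - T * ε * n ∧
      hits {u | h u ≠ f u ∧ u ∈ S} xt ≤ ε * n := by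
  obtain ⟨rfl, T, c, hmax, hgo, hlast, rfl⟩ := hout
  set h := ERM n x y
  have hnr : (1 : ℝ) ≤ n := by exact_mod_cast hn
  refine ⟨(hERM n x y).1, T, c, fun t ht => (hmax t ht.le).1, rfl, mul_le_one_of_run hn hgo, ?_,
    hits_agreeSet_le hn hgo, ?_⟩
  · exact fun i t ht => agree_of_score_pos hn (hε.trans (hgo t ht)) i
  · have h1 : ∀ i, h (x i) = y i := by
      have h2 := (hERM n x y).2 f hf
      have h3 : {i : Fin n | f (x i) ≠ y i} = ∅ := by ext i; simp [hy]
      rw [h3, Set.ncard_empty, Nat.le_zero, Set.ncard_eq_zero, Set.eq_empty_iff_forall_notMem] at h2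
      exact fun i => not_not.1 (h2 i)
    have h4 : empErr x h Set.univ f = 0 := by
      have : {i : Fin n | f (x i) ≠ h (x i) ∧ x i ∈ Set.univ} = ∅ := by ext i; simp [hy, h1]
      rw [empErr, this]
      simp
    -- The target has no training error against `h`, so its score is exactly the test error of `h`
    -- on the selection; maximality of `c T` bounds it by `ε`.
    have h5 := ((hmax T le_rfl).2 f hf).trans hlast
    rw [score, h4, mul_zero, sub_zero, empErr_eq_hits, div_le_iff₀ (by linarith)] at h5
    simpa only [ne_comm] using h5

end Run

/-! ### Error and rejection sets as local families of fixed arity. -/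

section Sets

variable {X : Type*} {k T : ℕ} {h f : X → Bool} {c : ℕ → X → Bool}

/-- The points selected by `θ 0, …, θ k` at which `θ 0` differs from `f`. -/
def errSet (f : X → Bool) (θ : Fin (k + 1) → X → Bool) : Set X :=
  {u | θ 0 u ≠ f u ∧ ∀ j, θ j u = θ 0 u}

/-- The points rejected by `θ 0, …, θ k`. -/
def rejSet (θ : Fin (k + 1) → X → Bool) : Set X := {u | ¬ ∀ j, θ j u = θ 0 u}

/-- The target is a fixed parameter, so it does not count in the growth bound. -/
lemma isLocal_errSet (f : X → Bool) : IsLocal (errSet (k := k) f) := by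
  intro θ θ' u hu
  simp [errSet, hu]

lemma isLocal_rejSet : IsLocal (rejSet (X := X) (k := k)) := by
  intro θ θ' u hu
  simp [rejSet, hu]

/-- The classifiers of a run of length `T`, padded with copies of the first one. -/
def padded (k T : ℕ) (h : X → Bool) (c : ℕ → X → Bool) : Fin (k + 1) → X → Bool :=
  Fin.cons h fun j => if (j : ℕ) < T then c j else h

lemma padded_mem {C : Set (X → Bool)} (hh : h ∈ C) (hc : ∀ t < T, c t ∈ C) (j : Fin (k + 1)) :
    padded k T h c j ∈ C := by
  refine Fin.cases ?_ (fun j => ?_) j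
  · simpa [padded] using hh
  · simp only [padded, Fin.cons_succ]
    split_ifs with hj
    · exact hc _ hj
    · exact hh

lemma forall_padded_iff (hT : T ≤ k) (u : X) :
    (∀ j, padded k T h c j u = padded k T h c 0 u) ↔ u ∈ agreeSet h c T := by
  rw [Fin.forall_fin_succ]
  simp only [padded, Fin.cons_zero, Fin.cons_succ, true_and]
  constructor
  · intro hu t ht
    simpa [ht] using hu ⟨t, by omega⟩
  · intro hu j
    split_ifs with hj
    · exact hu _ hj
    · rfl

lemma errSet_padded (hT : T ≤ k) :
    errSet f (padded k T h c) = {u | h u ≠ f u ∧ u ∈ agreeSet h c T} := by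
  ext u
  rw [errSet, Set.mem_ofPred_eq, forall_padded_iff hT]
  simp [padded]

lemma rejSet_padded (hT : T ≤ k) : rejSet (padded k T h c) = {u | u ∉ agreeSet h c T} := by
  ext u
  rw [rejSet, Set.mem_ofPred_eq, forall_padded_iff hT]
  rfl

end Sets

/-! ### Numerical estimates. -/

section Numerics

lemma log_four_thirds_gt : 0.26 < Real.log (4 / 3) := by
  rw [Real.lt_log_iff_exp_lt (by norm_num)]
  refine (Real.exp_bound' (by norm_num) (by norm_num) (n := 4) (by norm_num)).trans_lt ?_
  norm_num [Finset.sum_range_succ, Nat.factorial]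

lemma two_mul_log_four_thirds_sub_gt : 0.16925 < 2 * Real.log (4 / 3) - Real.log (3 / 2) := by
  have h1 : 2 * Real.log (4 / 3) - Real.log (3 / 2) = Real.log (32 / 27) := by
    have h2 : (2 : ℝ) * Real.log (4 / 3) = Real.log ((4 / 3) ^ 2) := by
      rw [Real.log_pow]; push_cast; ring
    rw [h2, ← Real.log_div (by norm_num) (by norm_num)]
    norm_num
  rw [h1, Real.lt_log_iff_exp_lt (by norm_num)]
  refine (Real.exp_bound' (by norm_num) (by norm_num) (n := 5) (by norm_num)).trans_lt ?_
  norm_num [Finset.sum_range_succ, Nat.factorial]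

lemma log_three_halves_le : Real.log (3 / 2) ≤ 1 / 2 := by
  linarith [Real.log_le_sub_one_of_pos (show (0 : ℝ) < 3 / 2 by norm_num)]

/-- The rate at which the union bound over `K` classifiers is compensated. -/
lemma growth_mul_exp_le {n d K : ℕ} {δ ε κ r : ℝ} (hn : 1 ≤ n) (hδ : 0 < δ) (hδ1 : δ < 1)
    (hε : ε = Real.sqrt (8 * (d * Real.log (2 * n) / n)) + 8 * Real.log (32 / δ) / n)
    (hε1 : ε < 1) (hκ : 1 / 8 ≤ κ) (hK : K * 1.01 * ε ≤ 8 * κ) (hr : κ * ε ≤ r) :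
    ((2 * n + 1 : ℝ)) ^ (d * K) * Real.exp (-(n * r)) ≤ δ / 32 := by
  have hnr : (1 : ℝ) ≤ n := by exact_mod_cast hn
  set L := Real.log (2 * n)
  set M := Real.log (32 / δ)
  set u := Real.sqrt (8 * (d * L / n))
  set v := 8 * M / n
  have hL : 0 ≤ L := Real.log_nonneg (by linarith)
  have hM32 : Real.log 32 ≤ M := Real.log_le_log (by norm_num)
    (by rw [le_div_iff₀ hδ]; linarith)
  have hlog32 : 3.46 < Real.log 32 := by
    rw [show (32 : ℝ) = 2 ^ 5 by norm_num, Real.log_pow]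
    have := Real.log_two_gt_d9
    push_cast
    linarith
  have hM : 0 < M := by linarith
  have hu : 0 ≤ u := Real.sqrt_nonneg _
  have hv : 0 < v := by positivity
  have hεpos : 0 < ε := by rw [hε]; positivity
  have hu2 : u ^ 2 * n = 8 * (d * L) := by
    rw [Real.sq_sqrt (by positivity)]; field_simp
  have hvn : v * n = 8 * M := by simp only [v]; field_simp
  -- With `ε = u + v`, the slack in `u ^ 2 + ε * v ≤ ε ^ 2` is `u * v`.
  have hεn : 8 * (d * L) + ε * (8 * M) ≤ ε ^ 2 * n := by
    rw [← hu2, ← hvn, hε]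
    have : 0 ≤ u * v * n := by positivity
    nlinarith
  -- Since `ε < 1` and `8 * log 32 > 27`, the sample is large enough to replace `log (2n + 1)` by
  -- `1.01 * log (2n)`.
  have hn27 : 27 < (n : ℝ) := by
    have h1 : v < 1 := by linarith
    rw [div_lt_one (by linarith)] at h1
    linarith
  have hL' : Real.log (2 * n + 1) ≤ 1.01 * L := by
    have h1 : Real.log (2 * n + 1) - L ≤ 1 / (2 * n) := by
      rw [← Real.log_div (by positivity) (by positivity)]
      refine (Real.log_le_sub_one_of_pos (by positivity)).trans_eq ?_
      field_simp
      ring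
    have h2 : Real.log 32 ≤ L := Real.log_le_log (by norm_num) (by linarith)
    have h3 : 1 / (2 * (n : ℝ)) ≤ 1 / 54 := one_div_le_one_div_of_le (by norm_num) (by linarith)
    linarith
  have hmain : d * K * Real.log (2 * n + 1) + M ≤ n * r := by
    have hdL : 0 ≤ d * L := by positivity
    have h1 : d * K * Real.log (2 * n + 1) ≤ d * K * (1.01 * L) := by gcongr
    have h2 : ε * (d * K * (1.01 * L)) ≤ 8 * κ * (d * L) := by
      calc _ = K * 1.01 * ε * (d * L) := by ring
        _ ≤ _ := by gcongr
    have h3 : κ * (8 * (d * L) + ε * (8 * M)) ≤ κ * (ε ^ 2 * n) := by gcongr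
    have h4 : ε * M ≤ κ * (ε * (8 * M)) := by
      have : 0 ≤ ε * M := by positivity
      nlinarith
    have h5 : ε * (d * K * (1.01 * L) + M) ≤ ε * (n * (κ * ε)) := by nlinarith
    have h6 := le_of_mul_le_mul_left h5 hεpos
    have h7 : n * (κ * ε) ≤ n * r := by gcongr
    linarith
  have h8 : δ / 32 = Real.exp (-M) := by
    rw [← Real.log_inv, inv_div, Real.exp_log (by positivity)]
  have h9 : ((2 * n + 1 : ℝ)) ^ (d * K) = Real.exp (d * K * Real.log (2 * n + 1)) := by
    rw [← Real.exp_log (show (0 : ℝ) < 2 * n + 1 by positivity), ← Real.exp_nat_mul,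
      Real.log_exp]
    push_cast
    rfl
  rw [h8, h9, ← Real.exp_add, Real.exp_le_exp]
  linarith

end Numerics

/-! ### Probabilities of the failure events. -/

section Generalization

variable {X : Type*} [Countable X] [MeasurableSpace X] [MeasurableSingletonClass X]
  {D : Measure X} [IsProbabilityMeasure D] {C : Set (X → Bool)} {f : X → Bool} {n d : ℕ} {δ ε : ℝ}

/-- The two terms are `4 / 3` and `2 / 3`, so the constraint on the rates is tight. -/
lemma exp_log_four_thirds_add :
    Real.exp (Real.log (4 / 3)) + Real.exp (-Real.log (3 / 2)) ≤ 2 := by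
  rw [Real.exp_neg, Real.exp_log (by norm_num), Real.exp_log (by norm_num)]
  norm_num

/-- The relative deviation bound at the rates `log (4 / 3)` and `log (3 / 2)`. -/
lemma measureReal_exists_rarely_hit_le' {k : ℕ} (hC : HasVC C d) {B : (Fin k → X → Bool) → Set X}
    (hB : IsLocal B) (p r : ℝ) :
    (Measure.pi fun _ : Fin n => D).real
      {z | ∃ θ, (∀ j, θ j ∈ C) ∧ p < D.real (B θ) ∧ hits (B θ) z ≤ r * n} ≤
      (2 * n + 1) ^ (d * k) *
        Real.exp (-(n * (p * Real.log (4 / 3) - r * Real.log (3 / 2)))) :=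
  measureReal_exists_rarely_hit_le hC hB (Real.log_nonneg (by norm_num))
    (Real.log_le_log (by norm_num) (by norm_num)) exp_log_four_thirds_add p r

/-- The samples that fail to certify a small rejection rate. -/
def rejectionFailure (D : Measure X) (C : Set (X → Bool)) (n : ℕ) (ε : ℝ) : Set (Fin n → X) :=
  {z | ∃ θ : Fin (⌊1 / ε⌋₊ + 1) → X → Bool,
    (∀ j, θ j ∈ C) ∧ ε < D.real (rejSet θ) ∧ hits (rejSet θ) z ≤ 0 * n}

/-- The samples that fail to certify a small error for selections by few classifiers. -/
def errorFailure (D : Measure X) (C : Set (X → Bool)) (f : X → Bool) (n : ℕ) (ε : ℝ) :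
    Set (Fin n → X) :=
  {z | ∃ θ : Fin (⌊1.34 / ε⌋₊ - 1 + 1) → X → Bool,
    (∀ j, θ j ∈ C) ∧ 2 * ε < D.real (errSet f θ) ∧ hits (errSet f θ) z ≤ ε * n}

/-- The samples that fail to certify a small error after two large removals. -/
def errorFailureThree (D : Measure X) (C : Set (X → Bool)) (f : X → Bool) (n : ℕ) (ε : ℝ) :
    Set (Fin n → X) :=
  {z | ∃ θ : Fin (2 + 1) → X → Bool,
    (∀ j, θ j ∈ C) ∧ 2 * ε < D.real (errSet f θ) ∧ hits (errSet f θ) z ≤ (1 - 2 * ε) * n}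

/-- For `ε < 1` the `⌊1 / ε⌋₊ + 1` classifiers need `1.01 * (1 + ε) ≤ 8 * 0.26`, where `0.26 < log
(4 / 3)`. -/
lemma measureReal_rejectionFailure_le (hC : HasVC C d) (hn : 1 ≤ n) (hδ : 0 < δ) (hδ1 : δ < 1)
    (hε : ε = Real.sqrt (8 * (d * Real.log (2 * n) / n)) + 8 * Real.log (32 / δ) / n)
    (hε0 : 0 < ε) :
    (Measure.pi fun _ : Fin n => D).real (rejectionFailure D C n ε) ≤ δ / 32 := by
  rcases le_or_gt 1 ε with hε1 | hε1
  · have : rejectionFailure D C n ε = ∅ := by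
      refine Set.eq_empty_of_forall_notMem fun z ⟨θ, _, h, _⟩ => ?_
      linarith [measureReal_le_one (μ := D) (s := rejSet θ)]
    rw [this, measureReal_empty]
    positivity
  refine (measureReal_exists_rarely_hit_le' hC isLocal_rejSet ε 0).trans
    (growth_mul_exp_le hn hδ hδ1 hε hε1 (κ := 0.26) (by norm_num) ?_ ?_)
  · have h1 : (⌊1 / ε⌋₊ : ℝ) * ε ≤ 1 := by
      rw [← le_div_iff₀ hε0]
      exact Nat.floor_le (by positivity)
    push_cast
    linarith
  · nlinarith [log_four_thirds_gt]

/-- The rate is `ε * (2 * log (4 / 3) - log (3 / 2))`, and `1.34` barely meets `1.34 * 1.01 ≤ 8 *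
0.16925`. -/
lemma measureReal_errorFailure_le (hC : HasVC C d) (hn : 1 ≤ n) (hδ : 0 < δ) (hδ1 : δ < 1)
    (hε : ε = Real.sqrt (8 * (d * Real.log (2 * n) / n)) + 8 * Real.log (32 / δ) / n)
    (hε0 : 0 < ε) :
    (Measure.pi fun _ : Fin n => D).real (errorFailure D C f n ε) ≤ δ / 32 := by
  rcases le_or_gt (1 / 2) ε with hε1 | hε1
  · have : errorFailure D C f n ε = ∅ := by
      refine Set.eq_empty_of_forall_notMem fun z ⟨θ, _, h, _⟩ => ?_
      linarith [measureReal_le_one (μ := D) (s := errSet f θ)]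
    rw [this, measureReal_empty]
    positivity
  refine (measureReal_exists_rarely_hit_le' hC (isLocal_errSet f) (2 * ε) ε).trans
    (growth_mul_exp_le hn hδ hδ1 hε (by linarith) (κ := 0.16925) (by norm_num) ?_ ?_)
  · have h1 : (⌊1.34 / ε⌋₊ : ℝ) * ε ≤ 1.34 := by
      rw [← le_div_iff₀ hε0]
      exact Nat.floor_le (by positivity)
    have h2 : 1 ≤ ⌊1.34 / ε⌋₊ := by
      refine Nat.le_floor ?_
      rw [le_div_iff₀ hε0]
      push_cast
      linarith
    rw [Nat.sub_add_cancel h2]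
    linarith
  · nlinarith [two_mul_log_four_thirds_sub_gt]

/-- For three classifiers the rate is at least `1.52 * ε - 0.5`, which exceeds `0.3 * ε` once `ε ≥
0.44`. -/
lemma measureReal_errorFailureThree_le (hC : HasVC C d) (hn : 1 ≤ n) (hδ : 0 < δ) (hδ1 : δ < 1)
    (hε : ε = Real.sqrt (8 * (d * Real.log (2 * n) / n)) + 8 * Real.log (32 / δ) / n)
    (hε0 : 0.44 ≤ ε) :
    (Measure.pi fun _ : Fin n => D).real (errorFailureThree D C f n ε) ≤ δ / 32 := by
  rcases le_or_gt (1 / 2) ε with hε1 | hε1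
  · have : errorFailureThree D C f n ε = ∅ := by
      refine Set.eq_empty_of_forall_notMem fun z ⟨θ, _, h, _⟩ => ?_
      linarith [measureReal_le_one (μ := D) (s := errSet f θ)]
    rw [this, measureReal_empty]
    positivity
  refine (measureReal_exists_rarely_hit_le' hC (isLocal_errSet f) (2 * ε) (1 - 2 * ε)).trans
    (growth_mul_exp_le hn hδ hδ1 hε (by linarith) (κ := 0.3) (by norm_num) ?_ ?_)
  · push_cast
    linarith
  · have h1 : (1 - 2 * ε) * Real.log (3 / 2) ≤ (1 - 2 * ε) * (1 / 2) := by
      gcongr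
      · linarith
      · exact log_three_halves_le
    have h2 : 2 * ε * 0.26 ≤ 2 * ε * Real.log (4 / 3) := by
      gcongr
      exact log_four_thirds_gt.le
    linarith

end Generalization

/-! ### From good samples to guarantees for the output. -/

section Output

variable {X : Type*} [MeasurableSpace X] {C : Set (X → Bool)} {f : X → Bool} {n : ℕ} {ε : ℝ}

lemma rej_le_of_notMem {P : Measure X} {x : Fin n → X} {h : X → Bool} {c : ℕ → X → Bool} {T : ℕ}
    (hε : 0 < ε) (hh : h ∈ C) (hc : ∀ t < T, c t ∈ C) (hT : T * ε ≤ 1)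
    (hx : ∀ i, x i ∈ agreeSet h c T) (hgood : x ∉ rejectionFailure P C n ε) :
    rej P (agreeSet h c T) ≤ ε := by
  by_contra! hcon
  have hTk : T ≤ ⌊1 / ε⌋₊ := Nat.le_floor (by rwa [le_div_iff₀ hε])
  refine hgood ⟨padded _ T h c, padded_mem hh hc, ?_, ?_⟩
  · rwa [rejSet_padded hTk]
  · rw [rejSet_padded hTk, hits_eq_ncard]
    have : {i | x i ∈ {u | u ∉ agreeSet h c T}} = ∅ :=
      Set.eq_empty_of_forall_notMem fun i hi => hi (hx i)
    rw [this]
    simp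

lemma err_le_of_notMem {Q : Measure X} {xt : Fin n → X} {h : X → Bool} {c : ℕ → X → Bool} {T : ℕ}
    (hε : 0 < ε) (hh : h ∈ C) (hc : ∀ t < T, c t ∈ C) (hT : T * ε ≤ 1)
    (hsel : hits (agreeSet h c T) xt ≤ n - T * ε * n)
    (herr : hits {u | h u ≠ f u ∧ u ∈ agreeSet h c T} xt ≤ ε * n)
    [IsProbabilityMeasure Q]
    (hgood : xt ∉ errorFailure Q C f n ε)
    (hgood' : 0.44 ≤ ε → xt ∉ errorFailureThree Q C f n ε) :
    err Q h (agreeSet h c T) f ≤ 2 * ε := by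
  by_contra! hcon
  have hε1 : ε < 1 / 2 := by
    have : err Q h (agreeSet h c T) f ≤ 1 := measureReal_le_one
    linarith
  rcases Nat.lt_or_ge T ⌊1.34 / ε⌋₊ with hTk | hTk
  · have hTk' : T ≤ ⌊1.34 / ε⌋₊ - 1 := by omega
    refine hgood ⟨padded _ T h c, padded_mem hh hc, ?_, ?_⟩
    · rwa [errSet_padded hTk']
    · rwa [errSet_padded hTk']
  -- Together with `T * ε ≤ 1` this gives `ε > 0.34`, hence `T < 3`; and `ε < 1 / 2` excludes `T ≤
  -- 1`. In the remaining case `T = 2`, so `3 * ε > 1.34` and at most `(1 - 2 * ε) * n` test points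
  -- are still selected.
  · have h1 : 1.34 < (T + 1) * ε := by
      have h2 := (Nat.lt_floor_add_one (1.34 / ε))
      rw [div_lt_iff₀ hε] at h2
      refine h2.trans_le ?_
      gcongr
    have hT3 : T < 3 := by
      by_contra! h3
      have h4 : (3 : ℝ) ≤ T := by exact_mod_cast h3
      nlinarith
    have hT2 : T = 2 := by
      interval_cases T
      · norm_num at h1; linarith
      · norm_num at h1; linarith
      · rfl
    subst hT2
    push_cast at h1 hsel
    refine hgood' (by linarith) ⟨padded _ 2 h c, padded_mem hh hc, ?_, ?_⟩
    · rwa [errSet_padded le_rfl]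
    · rw [errSet_padded le_rfl]
      refine (hits_mono (fun u hu => hu.2) xt).trans (hsel.trans_eq ?_)
      ring

end Output

end Redaction

theorem mainTheorem8 :
    ∃ K : ℝ, 0 < K ∧
      ∀ (X : Type*) [Countable X] [MeasurableSpace X] [MeasurableSingletonClass X]
        (C : Set (X → Bool)) (d : ℕ), Redaction.vcDim C = d →
      ∀ (ERM : (m : ℕ) → (Fin m → X) → (Fin m → Bool) → X → Bool), Redaction.IsERM C ERM →
      ∀ (n : ℕ), 1 ≤ n →
      ∀ (δ : ℝ), 0 < δ →
      ∀ f ∈ C,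
      ∀ (P Q : MeasureTheory.Measure X)
        [MeasureTheory.IsProbabilityMeasure P] [MeasureTheory.IsProbabilityMeasure Q]
        (η : ℝ), η < 1 / 2 →
      ∀ (ηx : X → ℝ), (∀ x, 0 ≤ ηx x ∧ ηx x ≤ η) →
      ∀ (N : ℕ),
        K * ((d * n ^ 2 + Real.logb 2 (2 / δ)) / (δ ^ 2 * (1 - 2 * η) ^ 2)) ≤ N →
      ∀ (ε : ℝ),
        ε = Real.sqrt (8 * (d * Real.log (2 * n) / n)) + 8 * Real.log (32 / δ) / n →
        1 - δ ≤
          ((MeasureTheory.Measure.pi fun _ : Fin N => Redaction.massart P f ηx).prod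
            ((MeasureTheory.Measure.pi fun _ : Fin n => Redaction.massart P f ηx).prod
              (MeasureTheory.Measure.pi fun _ : Fin n => Q))).real
            {ω : (Fin N → X × Bool) × (Fin n → X × Bool) × (Fin n → X) |
              -- the denoising classifier, the training points and the test points
              let hhat : X → Bool := ERM N (fun i => (ω.1 i).1) (fun i => (ω.1 i).2)
              let x : Fin n → X := fun i => (ω.2.1 i).1
              let xt : Fin n → X := ω.2.2
              Redaction.RejectronTerminates C ERM x (fun i => hhat (x i)) xt ε (n + 1) ∧
              (∃ h S, Redaction.IsRejectronOutput C ERM x (fun i => hhat (x i)) xt ε (n + 1) h S) ∧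
              ∀ h S, Redaction.IsRejectronOutput C ERM x (fun i => hhat (x i)) xt ε (n + 1) h S →
                Redaction.err Q h S f ≤ 2 * ε ∧ Redaction.rej P S ≤ ε} := by
  refine ⟨40000, by norm_num, ?_⟩
  intro X _ _ _ C d hd ERM hERM n hn δ hδ f hf P Q _ _ η hη ηx hηx N hN ε hε
  rcases le_or_gt 1 δ with hδ1 | hδ1
  · exact (sub_nonpos.2 hδ1).trans measureReal_nonneg
  have hC := Redaction.hasVC_of_vcDim_eq hd
  have hηx1 : ∀ x, 0 ≤ ηx x ∧ ηx x ≤ 1 := fun x => ⟨(hηx x).1, by linarith [(hηx x).2]⟩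
  have := Redaction.isProbabilityMeasure_massart (P := P) (f := f) hηx1
  have hnr : (1 : ℝ) ≤ n := by exact_mod_cast hn
  have hε0 : 0 < ε := by
    have : 0 < Real.log (32 / δ) := Real.log_pos (by rw [lt_div_iff₀ hδ]; linarith)
    rw [hε]
    positivity
  set ν := Redaction.massart P f ηx
  set μN := Measure.pi fun _ : Fin N => ν
  set μn := Measure.pi fun _ : Fin n => ν
  set μQ := Measure.pi fun _ : Fin n => Q
  set μ := μN.prod (μn.prod μQ)
  set good := {ω : (Fin N → X × Bool) × (Fin n → X × Bool) × (Fin n → X) | _}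
  -- the four bad events
  let E₁ : Set ((Fin N → X × Bool) × (Fin n → X × Bool)) :=
    {w | ∃ i, Redaction.learned ERM w.1 (w.2 i).1 ≠ f (w.2 i).1}
  let E₂ := Redaction.rejectionFailure P C n ε
  let E₃ := Redaction.errorFailure Q C f n ε
  let E₄ := {z | 0.44 ≤ ε ∧ z ∈ Redaction.errorFailureThree Q C f n ε}
  have hp₁ : MeasurePreserving
      (fun ω : (Fin N → X × Bool) × (Fin n → X × Bool) × (Fin n → X) => (ω.1, ω.2.1)) μ
      (μN.prod μn) := (MeasurePreserving.id μN).prod measurePreserving_fst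
  have hp₂ : MeasurePreserving
      (fun ω : (Fin N → X × Bool) × (Fin n → X × Bool) × (Fin n → X) => fun i => (ω.2.1 i).1) μ
      (Measure.pi fun _ : Fin n => P) :=
    (measurePreserving_pi (fun _ : Fin n => ν) (fun _ : Fin n => P)
      fun _ => Redaction.measurePreserving_fst_massart hηx1).comp
      (measurePreserving_fst.comp measurePreserving_snd)
  have hp₃ : MeasurePreserving
      (fun ω : (Fin N → X × Bool) × (Fin n → X × Bool) × (Fin n → X) => ω.2.2) μ μQ :=
    measurePreserving_snd.comp measurePreserving_snd
  have h₁ : μ.real ((fun ω => (ω.1, ω.2.1)) ⁻¹' E₁) ≤ δ / 4 := by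
    rw [measureReal_def, hp₁.measure_preimage MeasurableSet.of_discrete.nullMeasurableSet]
    exact (Redaction.measureReal_exists_learned_ne_le hηx1).trans
      (Redaction.mul_integral_learned_error_le hC hERM hf hη hηx hn hδ hδ1 hN)
  have h₂ : μ.real ((fun ω i => (ω.2.1 i).1) ⁻¹' E₂) ≤ δ / 32 := by
    rw [measureReal_def, hp₂.measure_preimage MeasurableSet.of_discrete.nullMeasurableSet]
    exact Redaction.measureReal_rejectionFailure_le hC hn hδ hδ1 hε hε0
  have h₃ : μ.real ((fun ω => ω.2.2) ⁻¹' E₃) ≤ δ / 32 := by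
    rw [measureReal_def, hp₃.measure_preimage MeasurableSet.of_discrete.nullMeasurableSet]
    exact Redaction.measureReal_errorFailure_le hC hn hδ hδ1 hε hε0
  have h₄ : μ.real ((fun ω => ω.2.2) ⁻¹' E₄) ≤ δ / 32 := by
    rw [measureReal_def, hp₃.measure_preimage MeasurableSet.of_discrete.nullMeasurableSet]
    by_cases h44 : 0.44 ≤ ε
    · have : E₄ = Redaction.errorFailureThree Q C f n ε := by ext; simp [E₄, h44]
      rw [this]
      exact Redaction.measureReal_errorFailureThree_le hC hn hδ hδ1 hε h44
    · simp only [E₄, h44, false_and]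
      simp
      positivity
  have hsub : goodᶜ ⊆ ((fun ω => (ω.1, ω.2.1)) ⁻¹' E₁ ∪ (fun ω i => (ω.2.1 i).1) ⁻¹' E₂) ∪
      ((fun ω => ω.2.2) ⁻¹' E₃ ∪ (fun ω => ω.2.2) ⁻¹' E₄) := by
    intro ω hω
    by_contra hcon
    simp only [Set.mem_union, not_or] at hcon
    obtain ⟨⟨hω₁, hω₂⟩, hω₃, hω₄⟩ := hcon
    refine hω ⟨Redaction.rejectronTerminates hn hε0,
      Redaction.exists_isRejectronOutput ⟨f, hf⟩ hn hε0, fun h S hout => ?_⟩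
    -- Off `E₁` the denoised labels are the true ones, so the analysis of a noiseless run applies.
    have hy : ∀ i, f (ω.2.1 i).1 = Redaction.learned ERM ω.1 (ω.2.1 i).1 := fun i => by
      by_contra hne
      exact hω₁ ⟨i, fun h => hne h.symm⟩
    obtain ⟨hh, T, c, hc, rfl, hT, hx, hsel, herr⟩ := hout.spec hERM hf hn hε0 hy
    exact ⟨Redaction.err_le_of_notMem hε0 hh hc hT hsel herr hω₃ fun h44 h => hω₄ ⟨h44, h⟩,
      Redaction.rej_le_of_notMem hε0 hh hc hT hx hω₂⟩
  have hcompl : μ.real goodᶜ ≤ δ := by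
    refine (measureReal_mono hsub).trans ((measureReal_union_le _ _).trans ?_)
    have h5 := measureReal_union_le (μ := μ) ((fun ω => (ω.1, ω.2.1)) ⁻¹' E₁)
      ((fun ω i => (ω.2.1 i).1) ⁻¹' E₂)
    have h6 := measureReal_union_le (μ := μ) ((fun ω => ω.2.2) ⁻¹' E₃) ((fun ω => ω.2.2) ⁻¹' E₄)
    linarith
  rw [probReal_compl_eq_one_sub MeasurableSet.of_discrete] at hcompl
  linarith
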